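/- **Setting.** For each sample size $n$ let $p=p(n)\to\infty$, let $d_{\rm in},d_{\rm out}\in[p]=\{1,\dots,p\}$, let $c_1>0$, $c_2\ge 0$, $\alpha\in(0,1)$, $\gamma>0$, $\kappa\ge 0$ be hyperparameters and let $\Sigma^*\in\mathbb R^{p\times p}$ be positive definite (all of these may depend on $n$). Let $X$ be an $n\times p$ data matrix whose rows are i.i.d. $N_p(0,\Sigma^*)$; $X_j$ is its $j$-th column and $X_S$ the submatrix of the columns in $S\subseteq[p]$. A DAG $G$ on $[p]$ has parent sets $\mathrm{Pa}_j(G)$ and child sets $\mathrm{Ch}_j(G)$. For a permutation $\sigma$ of $[p]$, let $(B^*_\sigma,\Omega^*_\sigma)$ be the unique pair such that $(I-(B^*_\sigma)^\top)^{-1}\Omega^*_\sigma(I-B^*_\sigma)^{-1}=\Sigma^*$, $\Omega^*_\sigma$ is diagonal with positive diagonal, and $(B^*_\sigma)_{ij}=0$ whenever $\sigma^{-1}(i)\ge\sigma^{-1}(j)$. Let $G^*_\sigma$ be the DAG with $i\to j$ if and only if $(B^*_\sigma)_{ij}\ne 0$ (the minimal I-map of $N_p(0,\Sigma^*)$ with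 ordering $\sigma$), $S^*_{\sigma,j}=\mathrm{Pa}_j(G^*_\sigma)$, and $d^*=\max_\sigma\max_j|\mathrm{Pa}_j(G^*_\sigma)\cup\mathrm{Ch}_j(G^*_\sigma)|$. Let $\mathcal M^\sigma_p(j,d_{\rm in})$ be the set of all $S\subseteq\{k:\sigma^{-1}(k)<\sigma^{-1}(j)\}$ with $|S|\le d_{\rm in}$, and $\mathcal G^\sigma_p(d_{\rm in},d_{\rm out})$ the set of DAGs on $[p]$ with topological ordering $\sigma$, all in-degrees at most $d_{\rm in}$ and all out-degrees at most $d_{\rm out}$. The posterior scores are $\psi(G)=\sum_{j}\psi_j(\mathrm{Pa}_j(G))$ with $$e^{\psi_j(S)}=\Big\{c_1p^{c_2}\sqrt{1+\alpha/\gamma}\Big\}^{-|S|}\Big\{X_j^\top\big(I-X_S(X_S^\top X_S)^{-1}X_S^\top\big)X_j\Big\}^{-(\alpha n+\kappa)/2}.$$ For $S\in\mathcal M^\sigma_p(j,d_{\rm in})$ put $T=S^*_{\sigma,j}\setminus S$, $R=S\setminus S^*_{\sigma,j}$ and define $g^\sigma_j(S)$ as follows: $g_j^\sigma(S)=S$ if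 $S=S^*_{\sigma,j}$; $g_j^\sigma(S)=S\setminus\{\ell\}$ with $\ell\in R$ maximizing $\psi_j(S\setminus\{\ell\})$ if $S^*_{\sigma,j}\subsetneq S$; $g_j^\sigma(S)=S\cup\{k\}$ with $k\in T$ maximizing $\psi_j(S\cup\{k\})$ if $S^*_{\sigma,j}\not\subseteq S$ and $|S|<d_{\rm in}$; $g_j^\sigma(S)=(S\cup\{k\})\setminus\{\ell\}$ with $(k,\ell)\in T\times R$ maximizing $\psi_j((S\cup\{k\})\setminus\{\ell\})$ if $S^*_{\sigma,j}\not\subseteq S$ and $|S|=d_{\rm in}$. **Assumptions.** (A) There are $\underline\nu=\underline\nu(n)>0$, $\overline\nu=\overline\nu(n)>0$ and a constant $\delta_0\in(0,1)$ not depending on $n$ with $\underline\nu/(1-\delta_0)^2\le\lambda_{\min}(\Sigma^*)\le\lambda_{\max}(\Sigma^*)\le\overline\nu/(1+\delta_0)^2$. (B) $d_{\rm in}\log p=o(n)$. (C) $\kappa\le n$, $1\le c_1\sqrt{1+\alpha/\gamma}\le p$, and $c_2\ge(\alpha+1)(4d_{\rm in}+6)+t$ for a constant $t>0$ not depending on $n$.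 (DP) $(\nu_0+1)d^*\le d_{\rm in}$, where $\nu_0=4\overline\nu^2\underline\nu^{-4}(\overline\nu-\underline\nu)^2$. (EP) There is a constant $C_\beta>0$ not depending on $n$ such that for every $\sigma$ and all $i,j$ with $(B^*_\sigma)_{ij}\neq0$, $|(B^*_\sigma)_{ij}|^2\ge 5(C_\beta+4c_2)\dfrac{\overline\nu^2\log p}{\alpha\underline\nu^2n}$. **Theorem.** Assume (A), (B), (C), (DP), (EP) with $C_\beta\ge 8t/3$. Then for all sufficiently large $n$, with probability at least $1-3p^{-1}$, the following hold simultaneously: (i) $\psi_j(g^\sigma_j(S))-\psi_j(S)\ge t\log p$ for all permutations $\sigma$ of $[p]$, all $j\in[p]$ and all $S\in\mathcal M^\sigma_p(j,d_{\rm in})\setminus\{S^*_{\sigma,j}\}$; (ii) if $t>2$, then $\displaystyle\min_\sigma\min_{j\in[p]}\frac{\exp(\psi_j(S^*_{\sigma,j}))}{\sum_{S\in\mathcal M^\sigma_p(j,d_{\rm in})}\exp(\psi_j(S))}\ge 1-p^{-(t-2)}$; (iii) if $t>3$, then $\displaystyle\min_\sigma\frac{\exp(\psi(G^*_\sigma))}{\sum_{G\in\mathcal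 G^\sigma_p(d_{\rm in},d_{\rm out})}\exp(\psi(G))}\ge 1-p^{-(t-3)}$. -/

import Mathlib

open MeasureTheory ProbabilityTheory Filter Asymptotics
open scoped Matrix

noncomputable section

namespace DagSel

/-! ### Directed acyclic graphs on `Fin p` -/

/-- A directed acyclic graph with vertex set `Fin p`, given by its set of directed edges. -/
@[ext]
structure DAG (p : ℕ) where
  /-- `(i, j) ∈ edges` means `i → j`. -/
  edges : Finset (Fin p × Fin p)
  acyclic : ∀ v : Fin p, ¬ Relation.TransGen (fun i j => (i, j) ∈ edges) v v

instance (p : ℕ) : Finite (DAG p) :=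
  Finite.of_injective DAG.edges fun _ _ h => DAG.ext h

instance (p : ℕ) : Fintype (DAG p) := Fintype.ofFinite _

variable {p : ℕ}

/-- The parent set `Pa_j(G)`. -/
def DAG.parents (G : DAG p) (j : Fin p) : Finset (Fin p) :=
  Finset.univ.filter fun i => (i, j) ∈ G.edges

/-- The child set `Ch_j(G)`. -/
def DAG.children (G : DAG p) (j : Fin p) : Finset (Fin p) :=
  Finset.univ.filter fun i => (j, i) ∈ G.edges

/-- The maximum degree `max_j |Pa_j(G) ∪ Ch_j(G)|`. -/
def DAG.maxDegree (G : DAG p) : ℕ :=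
  Finset.univ.sup fun j => (G.parents j ∪ G.children j).card

/-- `σ` is a topological ordering of `G`; `σ i` is the node in position `i`. -/
def DAG.HasOrdering (G : DAG p) (σ : Equiv.Perm (Fin p)) : Prop :=
  ∀ i j : Fin p, (σ i, σ j) ∈ G.edges → i < j

open Classical in
/-- The DAGs with topological ordering `σ`, in-degrees at most `din` and out-degrees at most
`dout`. -/
def sparseDAGs (σ : Equiv.Perm (Fin p)) (din dout : ℕ) : Finset (DAG p) :=
  Finset.univ.filter fun G =>
    G.HasOrdering σ ∧ (∀ j, (G.parents j).card ≤ din) ∧ (∀ j, (G.children j).card ≤ dout)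

/-- The nodes that precede `j` in the ordering `σ`. -/
def predecessors (σ : Equiv.Perm (Fin p)) (j : Fin p) : Finset (Fin p) :=
  Finset.univ.filter fun k => σ.symm k < σ.symm j

/-- The candidate parent sets of node `j`: sets of at most `d` predecessors of `j` in `σ`. -/
def candidates (σ : Equiv.Perm (Fin p)) (j : Fin p) (d : ℕ) : Finset (Finset (Fin p)) :=
  (predecessors σ j).powerset.filter fun S => S.card ≤ d

/-! ### The modified Cholesky decomposition and the minimal I-maps -/

/-- `(B, diag ω)` is a modified Cholesky decomposition of `Sig` compatible with the ordering `σ`: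
`B i j ≠ 0` only if `i` precedes `j` in `σ`, all `ω i` are positive, and
`Sig = (I - Bᵀ)⁻¹ diag(ω) (I - B)⁻¹`. -/
def IsModifiedCholesky (Sig : Matrix (Fin p) (Fin p) ℝ) (σ : Equiv.Perm (Fin p))
    (B : Matrix (Fin p) (Fin p) ℝ) (ω : Fin p → ℝ) : Prop :=
  (∀ i j, σ.symm j ≤ σ.symm i → B i j = 0) ∧ (∀ i, 0 < ω i) ∧
    (1 - Bᵀ)⁻¹ * Matrix.diagonal ω * (1 - B)⁻¹ = Sig

open Classical in
/-- The weighted adjacency matrix `B*_σ` of the modified Cholesky decomposition of `Sig` compatible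
with `σ`. For positive definite `Sig` that decomposition exists and is unique; the value is `0` if
there is none. -/
def cholFactor (Sig : Matrix (Fin p) (Fin p) ℝ) (σ : Equiv.Perm (Fin p)) :
    Matrix (Fin p) (Fin p) ℝ :=
  if h : ∃ B ω, IsModifiedCholesky Sig σ B ω then h.choose else 0

theorem cholFactor_eq_zero (Sig : Matrix (Fin p) (Fin p) ℝ) (σ : Equiv.Perm (Fin p))
    (i j : Fin p) (hij : σ.symm j ≤ σ.symm i) : cholFactor Sig σ i j = 0 := by
  unfold cholFactor
  split_ifs with h
  · exact h.choose_spec.choose_spec.1 i j hij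
  · rfl

open Classical in
/-- The minimal I-map `G*_σ` of `N(0, Sig)` with ordering `σ`: the DAG with `i → j` if and only if
`(B*_σ) i j ≠ 0`. -/
def minimalIMap (Sig : Matrix (Fin p) (Fin p) ℝ) (σ : Equiv.Perm (Fin p)) : DAG p where
  edges := Finset.univ.filter fun e => cholFactor Sig σ e.1 e.2 ≠ 0
  acyclic := by
    have key : ∀ a b : Fin p, Relation.TransGen (fun i j => (i, j) ∈
        (Finset.univ.filter fun e : Fin p × Fin p => cholFactor Sig σ e.1 e.2 ≠ 0)) a b →
        σ.symm a < σ.symm b := by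
      have step : ∀ a b : Fin p, cholFactor Sig σ a b ≠ 0 → σ.symm a < σ.symm b := by
        intro a b hab
        by_contra hlt
        exact hab (cholFactor_eq_zero Sig σ a b (not_lt.mp hlt))
      intro a b hab
      induction hab with
      | single h => exact step _ _ (by simpa using h)
      | tail _ h ih => exact ih.trans (step _ _ (by simpa using h))
    intro v hv
    exact lt_irrefl _ (key v v hv)

/-- The true parent set `S*_{σ,j}`, i.e. the parent set of `j` in `G*_σ`. -/
def trueParents (Sig : Matrix (Fin p) (Fin p) ℝ) (σ : Equiv.Perm (Fin p)) (j : Fin p) :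
    Finset (Fin p) :=
  (minimalIMap Sig σ).parents j

/-- `d*`, the largest of the maximum degrees of all the minimal I-maps. -/
def dStar (Sig : Matrix (Fin p) (Fin p) ℝ) : ℕ :=
  Finset.univ.sup fun σ : Equiv.Perm (Fin p) => (minimalIMap Sig σ).maxDegree

/-! ### The posterior scores -/

/-- The hyperparameters of the empirical Bayes model. -/
structure Hyper where
  c₁ : ℝ
  c₂ : ℝ
  /-- exponent of the fractional likelihood -/
  α : ℝ
  γ : ℝ
  κ : ℝ

variable {n : ℕ}

/-- The columns of the data matrix `X` indexed by `S`. -/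
def cols (X : Matrix (Fin n) (Fin p) ℝ) (S : Finset (Fin p)) : Matrix (Fin n) S ℝ :=
  X.submatrix id (fun k : S => (k : Fin p))

/-- The residual sum of squares
`X_jᵀ (I - X_S (X_Sᵀ X_S)⁻¹ X_Sᵀ) X_j` of the regression of `X_j` on `X_S`. -/
def rss (X : Matrix (Fin n) (Fin p) ℝ) (j : Fin p) (S : Finset (Fin p)) : ℝ :=
  X.col j ⬝ᵥ ((1 - cols X S * ((cols X S)ᵀ * cols X S)⁻¹ * (cols X S)ᵀ) *ᵥ X.col j)

/-- The posterior score `ψ_j(S)` of the parent set `S` of node `j`, so that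
`exp (ψ_j(S)) = (c₁ p^{c₂} √(1 + α/γ))^{-|S|} (rss)^{-(α n + κ)/2}`. -/
def nodeScore (H : Hyper) (X : Matrix (Fin n) (Fin p) ℝ) (j : Fin p) (S : Finset (Fin p)) : ℝ :=
  Real.log (((H.c₁ * (p : ℝ) ^ H.c₂ * √(1 + H.α / H.γ)) ^ S.card)⁻¹ *
    rss X j S ^ (-(H.α * n + H.κ) / 2))

/-- The posterior score `ψ(G) = ∑_j ψ_j(Pa_j(G))` of a DAG. -/
def score (H : Hyper) (X : Matrix (Fin n) (Fin p) ℝ) (G : DAG p) : ℝ :=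
  ∑ j, nodeScore H X j (G.parents j)

/-! ### The add-delete-swap transition functions -/

/-- An element of `s` at which `f` is maximal over `s`. -/
def argmax {ι : Type*} (f : ι → ℝ) (s : Finset ι) (hs : s.Nonempty) : ι :=
  (s.exists_max_image f hs).choose

/-- The optimal add-delete-swap move `S ↦ g(S)` towards `Sstar` for the score `ψ`, on sets of size
at most `d`. An overfitted set loses its worst redundant element; an underfitted set gains its best
missing element, in exchange for a redundant one if it has the maximal size `d`.
(Ties do not affect `ψ (g(S))`. In the fallback `S`, there is no admissible move.) -/
def transition (ψ : Finset (Fin p) → ℝ) (d : ℕ) (Sstar S : Finset (Fin p)) : Finset (Fin p) :=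
  if S = Sstar then Sstar
  else if Sstar ⊆ S then
    if h : (S \ Sstar).Nonempty then
      S \ {argmax (fun l => ψ (S \ {l})) (S \ Sstar) h}
    else S
  else if S.card < d then
    if h : (Sstar \ S).Nonempty then
      S ∪ {argmax (fun k => ψ (S ∪ {k})) (Sstar \ S) h}
    else S
  else
    if h : ((Sstar \ S) ×ˢ (S \ Sstar)).Nonempty then
      (S ∪ {(argmax (fun kl : Fin p × Fin p => ψ ((S ∪ {kl.1}) \ {kl.2}))
          ((Sstar \ S) ×ˢ (S \ Sstar)) h).1}) \
        {(argmax (fun kl : Fin p × Fin p => ψ ((S ∪ {kl.1}) \ {kl.2}))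
          ((Sstar \ S) ×ˢ (S \ Sstar)) h).2}
    else S

/-- The transition function `g_j^σ` on the candidate parent sets of node `j` under `σ`. -/
def nodeTransition (Sig : Matrix (Fin p) (Fin p) ℝ) (H : Hyper) (X : Matrix (Fin n) (Fin p) ℝ)
    (din : ℕ) (σ : Equiv.Perm (Fin p)) (j : Fin p) (S : Finset (Fin p)) : Finset (Fin p) :=
  transition (nodeScore H X j) din (trueParents Sig σ j) S

end DagSel

end

open DagSel

/-! All randomness is confined to one event made of two conditions, `SparseConcentration` and
`NoiseBound`; on that event the three conclusions are deterministic.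

Gain of a move. Write X_j = Xβ + ε with β the j-th column of B*_σ; then ε = X(e_j - β) is
independent of the columns preceding j. Adding column k to S lowers the residual sum of squares by
the normalized squared projection of X_j on the residual of X_k given S (`rss_sub_rss_insert`), and
this projection splits into signal and noise. If S contains the true parents, there is no signal, so
a deletion costs only noise, which the penalty c₂ log p outweighs. If some true parents T are
missing, Cauchy-Schwarz and averaging over T yield one that carries a large share of the omitted
signal (`exists_strong_signal`). When S has maximal size, a redundant regressor must leave as well:
regressing the omitted signal on the columns present gives coefficients of norm at most (hi - lo)/(2
lo) times that of the omitted ones, so among the |R| ≥ ν₀|T| redundant regressors one has a small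
coefficient, and dropping it loses at most a quarter of the signal part of the guaranteed gain
(`exists_weak_signal`). `transition_gain` balances the constants.

From gains to posterior mass. One step suffices, without following paths to the true set: every S ≠
S* has weight at most p^{-t} times that of g(S), and g is at most p²-to-one, so the false sets
together have at most a fraction p^{2-t} of the total mass (`posterior_node_concentration`). The
posterior on DAGs is dominated by the product over the p nodes, which costs one more factor p
(`posterior_dag_concentration`).

Probability. A union bound over all orderings is unaffordable, but e_j - β depends on σ only through
the parent set (`cholResidual_eq_popResidual`). Hence the noise bound ranges over a node j, a parent
set A, a set S and a node k, at most p^{2d+2} choices, and a Gaussian tail at level (4d+6) log p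
fails with probability at most 2/p. Sparse eigenvalues follow from nets and chi-square tails, with
failure probability at most 1/p because d log p = o(n). -/

noncomputable section

namespace DagSel

/-! ### Least squares -/

section LeastSquares

variable {n p : ℕ}

/-- The least squares coefficients of `y` on the columns of `X` in `S`, extended by zero. -/
def olsCoef (X : Matrix (Fin n) (Fin p) ℝ) (S : Finset (Fin p)) (y : Fin n → ℝ) : Fin p → ℝ :=
  fun k => if h : k ∈ S then (((cols X S)ᵀ * cols X S)⁻¹ *ᵥ ((cols X S)ᵀ *ᵥ y)) ⟨k, h⟩ else 0

/-- The residual of the regression of `y` on the columns of `X` in `S`. -/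
def residual (X : Matrix (Fin n) (Fin p) ℝ) (S : Finset (Fin p)) (y : Fin n → ℝ) : Fin n → ℝ :=
  y - X *ᵥ olsCoef X S y

/-- The columns of `X` in `S` are linearly independent. -/
def FullRankOn (X : Matrix (Fin n) (Fin p) ℝ) (S : Finset (Fin p)) : Prop :=
  ∀ u : Fin p → ℝ, (∀ i ∉ S, u i = 0) → X *ᵥ u = 0 → u = 0

theorem FullRankOn.mono {X : Matrix (Fin n) (Fin p) ℝ} {S T : Finset (Fin p)} (h : FullRankOn X T)
    (hST : S ⊆ T) : FullRankOn X S :=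
  fun u hu => h u fun i hi => hu i fun hS => hi (hST hS)

theorem olsCoef_of_notMem (X : Matrix (Fin n) (Fin p) ℝ) {S : Finset (Fin p)} (y : Fin n → ℝ)
    {k : Fin p} (hk : k ∉ S) : olsCoef X S y k = 0 := by
  simp [olsCoef, hk]

theorem mulVec_eq_cols_mulVec (X : Matrix (Fin n) (Fin p) ℝ) {S : Finset (Fin p)}
    {u : Fin p → ℝ} (hu : ∀ i ∉ S, u i = 0) : X *ᵥ u = cols X S *ᵥ fun k : S => u k := by
  ext i
  simp only [Matrix.mulVec, dotProduct, cols, Matrix.submatrix_apply, id]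
  rw [Finset.sum_coe_sort S (fun k => X i k * u k)]
  refine (Finset.sum_subset (Finset.subset_univ S) fun k _ hk => ?_).symm
  rw [hu k hk, mul_zero]

theorem mulVec_olsCoef (X : Matrix (Fin n) (Fin p) ℝ) (S : Finset (Fin p)) (y : Fin n → ℝ) :
    X *ᵥ olsCoef X S y =
      cols X S *ᵥ (((cols X S)ᵀ * cols X S)⁻¹ *ᵥ ((cols X S)ᵀ *ᵥ y)) := by
  rw [mulVec_eq_cols_mulVec X fun i hi => olsCoef_of_notMem X y hi]
  congr 1
  ext k
  simp [olsCoef]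

theorem rss_eq_dotProduct_residual (X : Matrix (Fin n) (Fin p) ℝ) (j : Fin p)
    (S : Finset (Fin p)) : rss X j S = X.col j ⬝ᵥ residual X S (X.col j) := by
  unfold rss residual
  rw [mulVec_olsCoef, Matrix.sub_mulVec, Matrix.one_mulVec]
  simp only [← Matrix.mulVec_mulVec]

theorem isUnit_gram {X : Matrix (Fin n) (Fin p) ℝ} {S : Finset (Fin p)} (h : FullRankOn X S) :
    IsUnit ((cols X S)ᵀ * cols X S).det := by
  have hinj : Function.Injective (cols X S).mulVec := by
    intro a b hab
    have h1 := h (fun k => if hk : k ∈ S then a ⟨k, hk⟩ - b ⟨k, hk⟩ else 0)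
      (fun i hi => by simp [hi]) (by
        rw [mulVec_eq_cols_mulVec X (S := S) (fun i hi => by simp [hi])]
        have : (fun k : S => if hk : (k : Fin p) ∈ S then a ⟨k, hk⟩ - b ⟨k, hk⟩ else 0) = a - b := by
          ext k; simp
        rw [this, Matrix.mulVec_sub]
        exact sub_eq_zero.2 hab)
    ext k
    have := congrFun h1 k
    simp only [Finset.coe_mem, dite_true, Pi.zero_apply] at this
    exact sub_eq_zero.1 this
  have := (Matrix.PosDef.conjTranspose_mul_self (cols X S) hinj).det_pos
  rw [Matrix.conjTranspose_eq_transpose_of_trivial] at this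
  exact this.ne'.isUnit

/-- The normal equations. Full rank matters: a singular Gram matrix has inverse `0` by convention,
and the residual is then `y` itself. -/
theorem dotProduct_residual_of_mem {X : Matrix (Fin n) (Fin p) ℝ} {S : Finset (Fin p)}
    (h : FullRankOn X S) (y : Fin n → ℝ) {k : Fin p} (hk : k ∈ S) :
    X.col k ⬝ᵥ residual X S y = 0 := by
  have h1 : (cols X S)ᵀ *ᵥ residual X S y = 0 := by
    unfold residual
    rw [mulVec_olsCoef, Matrix.mulVec_sub, Matrix.mulVec_mulVec, Matrix.mulVec_mulVec,
      Matrix.mul_nonsing_inv _ (isUnit_gram h), Matrix.one_mulVec, sub_self]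
  exact congrFun h1 ⟨k, hk⟩

theorem mulVec_dotProduct (X : Matrix (Fin n) (Fin p) ℝ) (u : Fin p → ℝ) (r : Fin n → ℝ) :
    (X *ᵥ u) ⬝ᵥ r = ∑ k, u k * (X.col k ⬝ᵥ r) := by
  simp only [Matrix.mulVec, dotProduct, Finset.sum_mul, Finset.mul_sum, Matrix.col_apply]
  rw [Finset.sum_comm]
  refine Finset.sum_congr rfl fun k _ => Finset.sum_congr rfl fun i _ => by ring

theorem mulVec_dotProduct_eq_zero {X : Matrix (Fin n) (Fin p) ℝ} {S : Finset (Fin p)}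
    {r : Fin n → ℝ} (hr : ∀ k ∈ S, X.col k ⬝ᵥ r = 0) {u : Fin p → ℝ} (hu : ∀ i ∉ S, u i = 0) :
    (X *ᵥ u) ⬝ᵥ r = 0 := by
  rw [mulVec_dotProduct]
  refine Finset.sum_eq_zero fun k _ => ?_
  by_cases hk : k ∈ S
  · rw [hr k hk, mul_zero]
  · rw [hu k hk, zero_mul]

theorem mulVec_dotProduct_residual {X : Matrix (Fin n) (Fin p) ℝ} {S : Finset (Fin p)}
    (h : FullRankOn X S) (y : Fin n → ℝ) {u : Fin p → ℝ} (hu : ∀ i ∉ S, u i = 0) :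
    (X *ᵥ u) ⬝ᵥ residual X S y = 0 :=
  mulVec_dotProduct_eq_zero (fun _ hk => dotProduct_residual_of_mem h y hk) hu

theorem dotProduct_residual_self {X : Matrix (Fin n) (Fin p) ℝ} {S : Finset (Fin p)}
    (h : FullRankOn X S) (y : Fin n → ℝ) :
    residual X S y ⬝ᵥ residual X S y = y ⬝ᵥ residual X S y := by
  conv_lhs => enter [1]; rw [residual]
  rw [sub_dotProduct, mulVec_dotProduct_residual h y fun i hi => olsCoef_of_notMem X y hi, sub_zero]

theorem dotProduct_residual_comm {X : Matrix (Fin n) (Fin p) ℝ} {S : Finset (Fin p)}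
    (h : FullRankOn X S) (y z : Fin n → ℝ) :
    residual X S y ⬝ᵥ residual X S z = y ⬝ᵥ residual X S z := by
  conv_lhs => enter [1]; rw [residual]
  rw [sub_dotProduct, mulVec_dotProduct_residual h z fun i hi => olsCoef_of_notMem X y hi, sub_zero]

/-- The difference of two such vectors lies in the span of the columns in `S` and is orthogonal to
that span. -/
theorem residual_unique {X : Matrix (Fin n) (Fin p) ℝ} {S : Finset (Fin p)}
    (h : FullRankOn X S) {y r : Fin n → ℝ} {c : Fin p → ℝ} (hc : ∀ i ∉ S, c i = 0)
    (hr : r = y - X *ᵥ c) (hor : ∀ k ∈ S, X.col k ⬝ᵥ r = 0) : r = residual X S y := by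
  have hsupp : ∀ i ∉ S, (c - olsCoef X S y) i = 0 := fun i hi => by
    simp [hc i hi, olsCoef_of_notMem X y hi]
  have hd : residual X S y - r = X *ᵥ (c - olsCoef X S y) := by
    rw [hr, residual, Matrix.mulVec_sub]; abel
  have : (residual X S y - r) ⬝ᵥ (residual X S y - r) = 0 := by
    conv_lhs => enter [1]; rw [hd]
    rw [dotProduct_sub, mulVec_dotProduct_residual h y hsupp,
      mulVec_dotProduct_eq_zero hor hsupp, sub_zero]
  exact (sub_eq_zero.1 (dotProduct_self_eq_zero.1 this)).symm

theorem mulVec_single_one (X : Matrix (Fin n) (Fin p) ℝ) (k : Fin p) :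
    X *ᵥ Pi.single k 1 = X.col k := by
  simp

theorem residual_col (X : Matrix (Fin n) (Fin p) ℝ) (S : Finset (Fin p)) (k : Fin p) :
    residual X S (X.col k) = X *ᵥ (Pi.single k 1 - olsCoef X S (X.col k)) := by
  rw [Matrix.mulVec_sub, mulVec_single_one, residual]

theorem residual_col_dotProduct_self_pos {X : Matrix (Fin n) (Fin p) ℝ} {S : Finset (Fin p)}
    {k : Fin p} (hk : k ∉ S) (h : FullRankOn X (insert k S)) :
    0 < residual X S (X.col k) ⬝ᵥ residual X S (X.col k) := by
  refine lt_of_le_of_ne (Finset.sum_nonneg fun i _ => mul_self_nonneg _) fun h0 => ?_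
  have h1 := dotProduct_self_eq_zero.1 h0.symm
  rw [residual_col] at h1
  have h2 := h _ (fun i hi => by
    have := Finset.mem_insert.not.1 hi
    push Not at this
    simp [olsCoef_of_notMem X _ this.2, Pi.single_eq_of_ne this.1]) h1
  have := congrFun h2 k
  simp [olsCoef_of_notMem X _ hk] at this

/-- One Gram-Schmidt step: subtracting the projection on the part of `X_k` that is new given `S`
restores orthogonality, and `residual_unique` identifies the result. -/
theorem residual_insert {X : Matrix (Fin n) (Fin p) ℝ} {S : Finset (Fin p)} {k : Fin p}
    (hk : k ∉ S) (h : FullRankOn X (insert k S)) (y : Fin n → ℝ) :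
    residual X (insert k S) y = residual X S y -
      ((y ⬝ᵥ residual X S (X.col k)) / (residual X S (X.col k) ⬝ᵥ residual X S (X.col k))) •
        residual X S (X.col k) := by
  have hS : FullRankOn X S := h.mono (Finset.subset_insert k S)
  have hpos := residual_col_dotProduct_self_pos hk h
  set v := residual X S (X.col k) with hv
  set s := (y ⬝ᵥ v) / (v ⬝ᵥ v) with hs
  symm
  refine residual_unique h (c := olsCoef X S y + s • (Pi.single k 1 - olsCoef X S (X.col k)))
    (fun i hi => ?_) ?_ fun l hl => ?_
  · have := Finset.mem_insert.not.1 hi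
    push Not at this
    simp [olsCoef_of_notMem X _ this.2, Pi.single_eq_of_ne this.1]
  · rw [Matrix.mulVec_add, Matrix.mulVec_smul, ← residual_col, residual]
    abel
  · rw [dotProduct_sub, dotProduct_smul, smul_eq_mul]
    rcases Finset.mem_insert.1 hl with rfl | hl
    · have h1 : X.col l ⬝ᵥ v = v ⬝ᵥ v := (dotProduct_residual_self hS _).symm
      have h2 : X.col l ⬝ᵥ residual X S y = y ⬝ᵥ v := by
        rw [← dotProduct_residual_comm hS, dotProduct_comm, dotProduct_residual_comm hS]
      rw [h1, h2, hs]
      field_simp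
      ring
    · rw [dotProduct_residual_of_mem hS y hl, dotProduct_residual_of_mem hS _ hl]
      ring

/-- Every move is a composition of insertions and deletions of one element, so this reduces all
score comparisons to bounds on one squared projection. -/
theorem rss_sub_rss_insert {X : Matrix (Fin n) (Fin p) ℝ} {S : Finset (Fin p)} {k : Fin p}
    (hk : k ∉ S) (h : FullRankOn X (insert k S)) (j : Fin p) :
    rss X j S - rss X j (insert k S) = (X.col j ⬝ᵥ residual X S (X.col k)) ^ 2 /
      (residual X S (X.col k) ⬝ᵥ residual X S (X.col k)) := by
  rw [rss_eq_dotProduct_residual, rss_eq_dotProduct_residual, residual_insert hk h,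
    dotProduct_sub, dotProduct_smul, smul_eq_mul]
  ring

theorem rss_eq_dotProduct_self {X : Matrix (Fin n) (Fin p) ℝ} {S : Finset (Fin p)}
    (h : FullRankOn X S) (j : Fin p) :
    rss X j S = residual X S (X.col j) ⬝ᵥ residual X S (X.col j) := by
  rw [rss_eq_dotProduct_residual, dotProduct_residual_self h]

theorem residual_dotProduct_self_le {X : Matrix (Fin n) (Fin p) ℝ} {S : Finset (Fin p)}
    (h : FullRankOn X S) (y : Fin n → ℝ) :
    residual X S y ⬝ᵥ residual X S y ≤ y ⬝ᵥ y := by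
  have h1 : y = residual X S y + X *ᵥ olsCoef X S y := by simp [residual]
  have h2 : y ⬝ᵥ y = residual X S y ⬝ᵥ residual X S y +
      (X *ᵥ olsCoef X S y) ⬝ᵥ (X *ᵥ olsCoef X S y) := by
    have h3 := mulVec_dotProduct_residual h y fun i hi => olsCoef_of_notMem X y hi
    conv_lhs => rw [h1]
    rw [dotProduct_add, add_dotProduct, add_dotProduct, h3,
      dotProduct_comm (residual X S y) (X *ᵥ _), h3]
    ring
  rw [h2]
  have : 0 ≤ (X *ᵥ olsCoef X S y) ⬝ᵥ (X *ᵥ olsCoef X S y) :=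
    Finset.sum_nonneg fun i _ => mul_self_nonneg _
  linarith

end LeastSquares

/-! ### Signal strength in underfitted regressions -/

section Signal

variable {n p : ℕ}

/-- The eigenvalues of `X_AᵀX_A / N` lie in `[lo, hi]` for all `A` with at most `m` elements. -/
def SparseEigenvalues (X : Matrix (Fin n) (Fin p) ℝ) (N lo hi : ℝ) (m : ℕ) : Prop :=
  ∀ A : Finset (Fin p), A.card ≤ m → ∀ u : Fin p → ℝ, (∀ i ∉ A, u i = 0) →
    N * lo * (u ⬝ᵥ u) ≤ (X *ᵥ u) ⬝ᵥ (X *ᵥ u) ∧ (X *ᵥ u) ⬝ᵥ (X *ᵥ u) ≤ N * hi * (u ⬝ᵥ u)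

variable {X : Matrix (Fin n) (Fin p) ℝ} {N lo hi : ℝ} {m : ℕ}

theorem dotProduct_self_nonneg' {ι : Type*} [Fintype ι] (u : ι → ℝ) : 0 ≤ u ⬝ᵥ u :=
  Finset.sum_nonneg fun _ _ => mul_self_nonneg _

theorem SparseEigenvalues.fullRankOn (h : SparseEigenvalues X N lo hi m) (hN : 0 < N)
    (hlo : 0 < lo) {A : Finset (Fin p)} (hA : A.card ≤ m) : FullRankOn X A := by
  intro u hu hX
  have h1 := (h A hA u hu).1
  rw [hX, zero_dotProduct] at h1
  have h2 := dotProduct_self_nonneg' u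
  have : u ⬝ᵥ u ≤ 0 := by
    by_contra hc
    push Not at hc
    have : 0 < N * lo * (u ⬝ᵥ u) := by positivity
    linarith
  exact dotProduct_self_eq_zero.1 (le_antisymm this h2)

theorem dotProduct_eq_zero_of_disjoint {S T : Finset (Fin p)} (hST : Disjoint S T)
    {u v : Fin p → ℝ} (hu : ∀ i ∉ S, u i = 0) (hv : ∀ i ∉ T, v i = 0) : u ⬝ᵥ v = 0 := by
  refine Finset.sum_eq_zero fun i _ => ?_
  by_cases hi : i ∈ S
  · rw [hv i (Finset.disjoint_left.1 hST hi), mul_zero]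
  · rw [hu i hi, zero_mul]

theorem SparseEigenvalues.col_dotProduct_le (h : SparseEigenvalues X N lo hi m) (hm : 1 ≤ m)
    (k : Fin p) : X.col k ⬝ᵥ X.col k ≤ N * hi := by
  have := (h {k} (by simpa using hm) (Pi.single k 1) fun i hi => by
    simp only [Finset.mem_singleton] at hi; simp [hi]).2
  rw [mulVec_single_one] at this
  simpa using this

/-- Some missing regressor explains a share of the omitted signal. -/
theorem exists_strong_signal (h : SparseEigenvalues X N lo hi m) (hN : 0 < N) (hlo : 0 < lo)
    (hhi : 0 < hi) {S T : Finset (Fin p)} (hST : Disjoint S T) (hT : T.Nonempty)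
    (hm : (S ∪ T).card ≤ m) {β : Fin p → ℝ} (hβ : ∀ i ∉ T, β i = 0) :
    ∃ k ∈ T, N * lo ^ 2 * (β ⬝ᵥ β) * (residual X S (X.col k) ⬝ᵥ residual X S (X.col k)) ≤
      hi * T.card * ((X *ᵥ β) ⬝ᵥ residual X S (X.col k)) ^ 2 := by
  have hS : FullRankOn X S :=
    h.fullRankOn hN hlo ((Finset.card_le_card Finset.subset_union_left).trans hm)
  have hm1 : 1 ≤ m := (Finset.card_pos.2 (hT.mono Finset.subset_union_right)).trans_le hm
  set V := residual X S (X *ᵥ β) with hV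
  set g : Fin p → ℝ := fun k => X.col k ⬝ᵥ V with hg
  have hgk : ∀ k, (X *ᵥ β) ⬝ᵥ residual X S (X.col k) = g k := fun k => by
    rw [← dotProduct_residual_comm hS, dotProduct_comm, dotProduct_residual_comm hS]
  have hVV : V ⬝ᵥ V = ∑ k ∈ T, β k * g k := by
    rw [hV, dotProduct_residual_self hS, mulVec_dotProduct]
    refine (Finset.sum_subset (Finset.subset_univ T) fun k _ hk => ?_).symm
    rw [hβ k hk, zero_mul]
  -- The fitted coefficients live on `S` and `β` on the disjoint set `T`, so subtracting them can
  -- only lengthen the coefficient vector.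
  have hVlo : N * lo * (β ⬝ᵥ β) ≤ V ⬝ᵥ V := by
    have hc : ∀ i ∉ S, olsCoef X S (X *ᵥ β) i = 0 := fun i hi => olsCoef_of_notMem X _ hi
    have e : V = X *ᵥ (β - olsCoef X S (X *ᵥ β)) := by
      rw [Matrix.mulVec_sub, hV, residual]
    have h1 := (h (S ∪ T) hm (β - olsCoef X S (X *ᵥ β)) fun i hi => by
      rw [Finset.mem_union, not_or] at hi
      simp [hβ i hi.2, hc i hi.1]).1
    rw [← e, sub_dotProduct, dotProduct_sub, dotProduct_sub,
      dotProduct_eq_zero_of_disjoint hST.symm hβ hc,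
      dotProduct_eq_zero_of_disjoint hST hc hβ] at h1
    have h2 := dotProduct_self_nonneg' (olsCoef X S (X *ᵥ β))
    refine le_trans ?_ h1
    gcongr
    linarith
  have hββ : β ⬝ᵥ β = ∑ k ∈ T, β k ^ 2 := by
    simp only [dotProduct, ← pow_two]
    refine (Finset.sum_subset (Finset.subset_univ T) fun k _ hk => ?_).symm
    rw [hβ k hk]; simp
  have hb0 := dotProduct_self_nonneg' β
  -- Cauchy-Schwarz turns the lower bound on `V ⬝ᵥ V = ∑ β k * g k` into one on `∑ g k ^ 2`; the
  -- best `k` is at least average.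
  have hCS : (V ⬝ᵥ V) ^ 2 ≤ (β ⬝ᵥ β) * ∑ k ∈ T, g k ^ 2 := by
    rw [hVV, hββ]; exact Finset.sum_mul_sq_le_sq_mul_sq T β g
  have hsum : N ^ 2 * lo ^ 2 * (β ⬝ᵥ β) ≤ ∑ k ∈ T, g k ^ 2 := by
    rcases hb0.eq_or_lt with h0 | h0
    · rw [← h0, mul_zero]; positivity
    · have h1 : (N * lo * (β ⬝ᵥ β)) ^ 2 ≤ (V ⬝ᵥ V) ^ 2 := by gcongr
      have h2 := h1.trans hCS
      refine le_of_mul_le_mul_left ?_ h0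
      linarith
  obtain ⟨k, hk, hle⟩ : ∃ k ∈ T, N ^ 2 * lo ^ 2 * (β ⬝ᵥ β) / T.card ≤ g k ^ 2 := by
    refine Finset.exists_le_of_sum_le hT ?_
    rw [Finset.sum_const, nsmul_eq_mul]
    have : (T.card : ℝ) ≠ 0 := by exact_mod_cast (Finset.card_pos.2 hT).ne'
    field_simp
    linarith
  refine ⟨k, hk, ?_⟩
  have hTpos : (0 : ℝ) < T.card := by exact_mod_cast Finset.card_pos.2 hT
  rw [div_le_iff₀ hTpos] at hle
  rw [hgk]
  have hv := (residual_dotProduct_self_le hS (X.col k)).trans (h.col_dotProduct_le hm1 k)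
  calc N * lo ^ 2 * (β ⬝ᵥ β) * (residual X S (X.col k) ⬝ᵥ residual X S (X.col k))
      ≤ N * lo ^ 2 * (β ⬝ᵥ β) * (N * hi) := by gcongr
    _ = hi * (N ^ 2 * lo ^ 2 * (β ⬝ᵥ β)) := by ring
    _ ≤ hi * (g k ^ 2 * T.card) := by gcongr
    _ = _ := by ring

/-- The sample inner product of vectors with disjoint supports. -/
theorem SparseEigenvalues.abs_dotProduct_le (h : SparseEigenvalues X N lo hi m)
    {S T : Finset (Fin p)} (hST : Disjoint S T)
    (hm : (S ∪ T).card ≤ m) {u v : Fin p → ℝ} (hu : ∀ i ∉ S, u i = 0) (hv : ∀ i ∉ T, v i = 0) :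
    4 * ((X *ᵥ u) ⬝ᵥ (X *ᵥ v)) ≤ N * (hi - lo) * (u ⬝ᵥ u + v ⬝ᵥ v) := by
  have huv := dotProduct_eq_zero_of_disjoint hST hu hv
  have hvu : v ⬝ᵥ u = 0 := by rw [dotProduct_comm, huv]
  have h1 := (h (S ∪ T) hm (u + v) fun i hi => by
      rw [Finset.mem_union, not_or] at hi
      simp [hu i hi.1, hv i hi.2]).2
  have h2 := (h (S ∪ T) hm (u - v) fun i hi => by
      rw [Finset.mem_union, not_or] at hi
      simp [hu i hi.1, hv i hi.2]).1
  -- Polarization: the inner product is a difference of the forms at `u + v` and `u - v`, which have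
  -- equal norms because the supports are disjoint.
  simp only [Matrix.mulVec_add, Matrix.mulVec_sub, add_dotProduct, dotProduct_add, sub_dotProduct,
    dotProduct_sub, huv, hvu, dotProduct_comm (X *ᵥ v) (X *ᵥ u)] at h1 h2
  linarith

/-- The fit satisfies ‖Xb‖² = ⟨Xb, Xβ⟩: the left side is at least N lo ‖b‖², while disjoint supports
make the right side small when `hi - lo` is small. -/
theorem olsCoef_dotProduct_self_le (h : SparseEigenvalues X N lo hi m) (hN : 0 < N)
    (hlo : 0 < lo) (hlohi : lo ≤ hi) {S T : Finset (Fin p)} (hST : Disjoint S T)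
    (hm : (S ∪ T).card ≤ m) {β : Fin p → ℝ} (hβ : ∀ i ∉ T, β i = 0) :
    4 * lo ^ 2 * (olsCoef X S (X *ᵥ β) ⬝ᵥ olsCoef X S (X *ᵥ β)) ≤ (hi - lo) ^ 2 * (β ⬝ᵥ β) := by
  have hSm : S.card ≤ m := (Finset.card_le_card Finset.subset_union_left).trans hm
  have hS : FullRankOn X S := h.fullRankOn hN hlo hSm
  set b := olsCoef X S (X *ᵥ β) with hb
  have hbS : ∀ i ∉ S, b i = 0 := fun i hi => olsCoef_of_notMem X _ hi
  have e : (X *ᵥ b) ⬝ᵥ (X *ᵥ β) = (X *ᵥ b) ⬝ᵥ (X *ᵥ b) := by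
    have := mulVec_dotProduct_residual hS (X *ᵥ β) hbS
    rw [residual, dotProduct_sub] at this
    exact sub_eq_zero.1 this
  have hlow := (h S hSm b hbS).1
  have hb0 := dotProduct_self_nonneg' b
  have hβ0 := dotProduct_self_nonneg' β
  have hs : ∀ s : ℝ, 0 < s → 4 * (lo * (b ⬝ᵥ b)) * s ≤ (hi - lo) * (s ^ 2 * (b ⬝ᵥ b) + β ⬝ᵥ β) := by
    intro s hs
    have h1 := h.abs_dotProduct_le hST hm (u := s • b) (v := β)
      (fun i hi => by simp [hbS i hi]) hβ
    simp only [Matrix.mulVec_smul, smul_dotProduct, dotProduct_smul, smul_eq_mul] at h1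
    rw [e] at h1
    have h2 : 4 * (s * (N * lo * (b ⬝ᵥ b))) ≤ N * (hi - lo) * (s * (s * (b ⬝ᵥ b)) + β ⬝ᵥ β) := by
      refine le_trans ?_ h1
      gcongr
    refine le_of_mul_le_mul_left ?_ hN
    linarith
  rcases hlohi.eq_or_lt with hh | hh
  · have := hs 1 one_pos
    rw [hh, sub_self] at this
    have : hi * (b ⬝ᵥ b) ≤ 0 := by linarith
    rw [hh]
    have : hi * (hi * (b ⬝ᵥ b)) ≤ 0 := by
      have := mul_nonneg (hlo.le.trans hlohi) (neg_nonneg.2 this)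
      linarith
    nlinarith
  · have hd : 0 < hi - lo := sub_pos.2 hh
    -- The scaling of `b` against `β` that gives the sharpest bound on `b ⬝ᵥ b`.
    have := hs (2 * lo / (hi - lo)) (by positivity)
    field_simp at this
    nlinarith

/-- Some redundant regressor carries little of the omitted signal. -/
theorem exists_weak_signal (h : SparseEigenvalues X N lo hi m) (hN : 0 < N) (hlo : 0 < lo)
    (hlohi : lo ≤ hi) {S T R : Finset (Fin p)} (hST : Disjoint S T) (hRS : R ⊆ S)
    (hR : R.Nonempty) (hm : (S ∪ T).card ≤ m) {β : Fin p → ℝ} (hβ : ∀ i ∉ T, β i = 0) :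
    ∃ l ∈ R, 4 * lo ^ 2 * R.card *
        ((X *ᵥ β) ⬝ᵥ residual X (S.erase l) (X.col l)) ^ 2 ≤
      N * hi * (hi - lo) ^ 2 * (β ⬝ᵥ β) *
        (residual X (S.erase l) (X.col l) ⬝ᵥ residual X (S.erase l) (X.col l)) := by
  have hSm : S.card ≤ m := (Finset.card_le_card Finset.subset_union_left).trans hm
  have hS : FullRankOn X S := h.fullRankOn hN hlo hSm
  have hm1 : 1 ≤ m := (Finset.card_pos.2 (hR.mono hRS)).trans_le hSm
  have hhi : 0 < hi := hlo.trans_le hlohi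
  set b := olsCoef X S (X *ᵥ β) with hb
  have hbS : ∀ i ∉ S, b i = 0 := fun i hi => olsCoef_of_notMem X _ hi
  have hRpos : (0 : ℝ) < R.card := by exact_mod_cast Finset.card_pos.2 hR
  obtain ⟨l, hl, hle⟩ : ∃ l ∈ R, b l ^ 2 ≤ (b ⬝ᵥ b) / R.card := by
    refine Finset.exists_le_of_sum_le hR ?_
    rw [Finset.sum_const, nsmul_eq_mul, mul_div_cancel₀ _ hRpos.ne']
    simp only [dotProduct, ← pow_two]
    exact Finset.sum_le_sum_of_subset_of_nonneg (Finset.subset_univ R) fun _ _ _ => sq_nonneg _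
  refine ⟨l, hl, ?_⟩
  have hlS := hRS hl
  have hE : FullRankOn X (S.erase l) := hS.mono (Finset.erase_subset l S)
  set u := residual X (S.erase l) (X.col l) with hu
  -- Frisch-Waugh: the projection on the residual of `X_l` reads off the coefficient of `l` in the
  -- fit on all of `S`, so a small coefficient means little signal.
  have hXb : (X *ᵥ β) ⬝ᵥ u = b l * (u ⬝ᵥ u) := by
    have h1 : X *ᵥ β = X *ᵥ b + residual X S (X *ᵥ β) := by simp [residual, hb]
    have h2 : residual X S (X *ᵥ β) ⬝ᵥ u = 0 := by
      rw [dotProduct_comm, hu, residual_col]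
      refine mulVec_dotProduct_residual hS _ fun i hi => ?_
      have : i ≠ l := fun e => hi (e ▸ hlS)
      simp [this, olsCoef_of_notMem X _ (fun hc => hi (Finset.mem_of_mem_erase hc))]
    rw [h1, add_dotProduct, h2, add_zero, mulVec_dotProduct,
      Finset.sum_eq_single l (fun k _ hk => ?_) (by simp), hu, dotProduct_residual_self hE]
    by_cases hkS : k ∈ S
    · rw [dotProduct_residual_of_mem hE _ (Finset.mem_erase.2 ⟨hk, hkS⟩), mul_zero]
    · rw [hbS k hkS, zero_mul]
  have huu : u ⬝ᵥ u ≤ N * hi := (residual_dotProduct_self_le hE _).trans (h.col_dotProduct_le hm1 l)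
  have hu0 := dotProduct_self_nonneg' u
  have hbb := olsCoef_dotProduct_self_le h hN hlo hlohi hST hm hβ
  rw [le_div_iff₀ hRpos] at hle
  have hβ0 := dotProduct_self_nonneg' β
  rw [hXb]
  calc 4 * lo ^ 2 * R.card * (b l * (u ⬝ᵥ u)) ^ 2
      = 4 * lo ^ 2 * (b l ^ 2 * R.card) * (u ⬝ᵥ u) * (u ⬝ᵥ u) := by ring
    _ ≤ 4 * lo ^ 2 * (b ⬝ᵥ b) * (u ⬝ᵥ u) * (u ⬝ᵥ u) := by gcongr
    _ ≤ (hi - lo) ^ 2 * (β ⬝ᵥ β) * (u ⬝ᵥ u) * (N * hi) := by gcongr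
    _ = _ := by ring

end Signal

/-! ### Score differences along the moves -/

section Moves

variable {n p : ℕ}

/-- The complexity penalty of a single regressor. -/
def penalty (H : Hyper) (p : ℕ) : ℝ := Real.log (H.c₁ * (p : ℝ) ^ H.c₂ * √(1 + H.α / H.γ))

theorem nodeScore_eq {H : Hyper} {X : Matrix (Fin n) (Fin p) ℝ} {j : Fin p} {S : Finset (Fin p)}
    (hH : 0 < H.c₁ * (p : ℝ) ^ H.c₂ * √(1 + H.α / H.γ)) (hr : 0 < rss X j S) :
    nodeScore H X j S =
      -(S.card * penalty H p) - (H.α * n + H.κ) / 2 * Real.log (rss X j S) := by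
  rw [nodeScore, Real.log_mul (by positivity) (by positivity), Real.log_inv, Real.log_pow,
    Real.log_rpow hr, penalty]
  ring

theorem penalty_bounds {H : Hyper} (hp : 1 ≤ p)
    (hc : 1 ≤ H.c₁ * √(1 + H.α / H.γ) ∧ H.c₁ * √(1 + H.α / H.γ) ≤ p) :
    0 < H.c₁ * (p : ℝ) ^ H.c₂ * √(1 + H.α / H.γ) ∧ H.c₂ * Real.log p ≤ penalty H p ∧
      penalty H p ≤ (H.c₂ + 1) * Real.log p := by
  have hp0 : (0 : ℝ) < p := by exact_mod_cast hp
  have h0 : 0 < H.c₁ * √(1 + H.α / H.γ) := lt_of_lt_of_le one_pos hc.1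
  have e : H.c₁ * (p : ℝ) ^ H.c₂ * √(1 + H.α / H.γ) =
      (H.c₁ * √(1 + H.α / H.γ)) * (p : ℝ) ^ H.c₂ := by ring
  have e2 : penalty H p = Real.log (H.c₁ * √(1 + H.α / H.γ)) + H.c₂ * Real.log p := by
    rw [penalty, e, Real.log_mul h0.ne' (by positivity), Real.log_rpow hp0]
  refine ⟨by rw [e]; positivity, ?_, ?_⟩
  · have := Real.log_nonneg hc.1
    linarith
  · have := Real.log_le_log h0 hc.2
    linarith

theorem log_sub_log_le {r r' : ℝ} (hr : 0 < r) (hr' : 0 < r') :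
    Real.log r' - Real.log r ≤ (r' - r) / r := by
  rw [← Real.log_div hr'.ne' hr.ne']
  refine (Real.log_le_sub_one_of_pos (by positivity)).trans_eq ?_
  field_simp

theorem le_argmax {ι : Type*} (f : ι → ℝ) (s : Finset ι) (hs : s.Nonempty) {x : ι} (hx : x ∈ s) :
    f x ≤ f (argmax f s hs) :=
  (s.exists_max_image f hs).choose_spec.2 x hx

theorem argmax_mem {ι : Type*} (f : ι → ℝ) (s : Finset ι) (hs : s.Nonempty) :
    argmax f s hs ∈ s :=
  (s.exists_max_image f hs).choose_spec.1

variable {X : Matrix (Fin n) (Fin p) ℝ} {j : Fin p}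

/-- Deleting a redundant regressor. -/
theorem nodeScore_delete {H : Hyper} {S : Finset (Fin p)} {l : Fin p} (hl : l ∈ S)
    {ω ρ L t : ℝ} (hH : 0 < H.c₁ * (p : ℝ) ^ H.c₂ * √(1 + H.α / H.γ))
    (hn : 0 < n) (hα : 0 ≤ H.α) (hκ : 0 ≤ H.κ) (hκn : H.κ ≤ n) (hω : 0 < ω) (hρL : 0 ≤ ρ * L)
    (hpen : H.c₂ * L ≤ penalty H p) (hL : 0 ≤ L) (hc₂ : (H.α + 1) * ρ + t ≤ H.c₂)
    (hr : n * ω / 2 ≤ rss X j S) (hr' : 0 < rss X j (S \ {l}))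
    (hdiff : rss X j (S \ {l}) - rss X j S ≤ ω * (ρ * L)) :
    t * L ≤ nodeScore H X j (S \ {l}) - nodeScore H X j S := by
  have hn' : (0 : ℝ) < n := by exact_mod_cast hn
  have hr0 : 0 < rss X j S := lt_of_lt_of_le (by positivity) hr
  rw [nodeScore_eq hH hr0, nodeScore_eq hH hr', Finset.card_sdiff_of_subset (by simpa using hl)]
  have hcard : ((S.card - ({l} : Finset (Fin p)).card : ℕ) : ℝ) = S.card - 1 := by
    rw [Finset.card_singleton, Nat.cast_sub (Finset.card_pos.2 ⟨l, hl⟩), Nat.cast_one]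
  rw [hcard]
  -- The bound `n * ω / 2 ≤ rss` makes the scale `ω` cancel. The exponent, at most (α + 1) n / 2,
  -- then leaves (α + 1) ρ L, which the penalty exceeds by `t * L`.
  have h1 : Real.log (rss X j (S \ {l})) - Real.log (rss X j S) ≤ 2 * (ρ * L) / n := by
    refine (log_sub_log_le hr0 hr').trans ?_
    calc (rss X j (S \ {l}) - rss X j S) / rss X j S ≤ ω * (ρ * L) / rss X j S := by gcongr
      _ ≤ ω * (ρ * L) / (n * ω / 2) := by gcongr
      _ = 2 * (ρ * L) / n := by field_simp
  have h2 : (H.α * n + H.κ) / 2 * (Real.log (rss X j (S \ {l})) - Real.log (rss X j S)) ≤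
      (H.α + 1) * (ρ * L) := by
    calc _ ≤ (H.α * n + H.κ) / 2 * (2 * (ρ * L) / n) := by gcongr
      _ ≤ (H.α * n + n) / 2 * (2 * (ρ * L) / n) := by gcongr
      _ = _ := by field_simp
  have h3 := mul_le_mul_of_nonneg_right hc₂ hL
  linarith

/-- A drop of `y * hi` is at least a fraction `y / n` of a residual sum of squares bounded by `n *
hi`, so the logarithm falls by at least `y / n`. -/
theorem le_mul_log_sub_log {H : Hyper} {r r' hi y : ℝ} (hn : 0 < n) (hα : 0 ≤ H.α) (hκ : 0 ≤ H.κ)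
    (hhi : 0 < hi) (hr : 0 < r) (hr' : 0 < r') (hrn : r ≤ n * hi) (hy : 0 ≤ y)
    (hdiff : y * hi ≤ r - r') :
    H.α * y / 2 ≤ (H.α * n + H.κ) / 2 * (Real.log r - Real.log r') := by
  have hn' : (0 : ℝ) < n := by exact_mod_cast hn
  have h1 : y / n ≤ Real.log r - Real.log r' := by
    have h2 := log_sub_log_le hr hr'
    have h3 : y / n ≤ (r - r') / r := by
      calc y / n = y * hi / (n * hi) := by field_simp
        _ ≤ y * hi / r := by gcongr
        _ ≤ _ := by gcongr
    have h4 : (r' - r) / r = -((r - r') / r) := by ring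
    linarith
  calc H.α * y / 2 = (H.α * n) / 2 * (y / n) := by field_simp
    _ ≤ (H.α * n + H.κ) / 2 * (y / n) := by gcongr; linarith
    _ ≤ _ := by gcongr

/-- Adding a missing regressor. -/
theorem nodeScore_add {H : Hyper} {S : Finset (Fin p)} {k : Fin p} (hk : k ∉ S)
    {hi y L t : ℝ} (hH : 0 < H.c₁ * (p : ℝ) ^ H.c₂ * √(1 + H.α / H.γ))
    (hn : 0 < n) (hα : 0 ≤ H.α) (hκ : 0 ≤ H.κ) (hhi : 0 < hi) (hy : 0 ≤ y)
    (hpen : penalty H p ≤ (H.c₂ + 1) * L) (hr : 0 < rss X j S) (hr' : 0 < rss X j (S ∪ {k}))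
    (hrn : rss X j S ≤ n * hi) (hdiff : y * hi ≤ rss X j S - rss X j (S ∪ {k}))
    (hyt : (H.c₂ + 1 + t) * L ≤ H.α * y / 2) :
    t * L ≤ nodeScore H X j (S ∪ {k}) - nodeScore H X j S := by
  rw [nodeScore_eq hH hr, nodeScore_eq hH hr',
    Finset.card_union_of_disjoint (by simpa using hk), Finset.card_singleton]
  have := le_mul_log_sub_log hn hα hκ hhi hr hr' hrn hy hdiff
  push_cast
  linarith

/-- Swapping a redundant regressor for a missing one. -/
theorem nodeScore_swap {H : Hyper} {S S' : Finset (Fin p)} (hcard : S'.card = S.card)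
    {hi y L t : ℝ} (hH : 0 < H.c₁ * (p : ℝ) ^ H.c₂ * √(1 + H.α / H.γ))
    (hn : 0 < n) (hα : 0 ≤ H.α) (hκ : 0 ≤ H.κ) (hhi : 0 < hi) (hy : 0 ≤ y)
    (hr : 0 < rss X j S) (hr' : 0 < rss X j S')
    (hrn : rss X j S ≤ n * hi) (hdiff : y * hi ≤ rss X j S - rss X j S')
    (hyt : t * L ≤ H.α * y / 2) :
    t * L ≤ nodeScore H X j S' - nodeScore H X j S := by
  rw [nodeScore_eq hH hr, nodeScore_eq hH hr', hcard]
  have := le_mul_log_sub_log hn hα hκ hhi hr hr' hrn hy hdiff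
  linarith

/-- The relation between the response `X_j`, the signal `Xβ` and the noise on which the
analysis of the moves rests. -/
structure NodeModel (X : Matrix (Fin n) (Fin p) ℝ) (j : Fin p) (A Sstar : Finset (Fin p))
    (β : Fin p → ℝ) (ω lo hi noise b : ℝ) (d : ℕ) : Prop where
  notMem : j ∉ A
  subset : Sstar ⊆ A
  support : ∀ i ∉ Sstar, β i = 0
  lo_pos : 0 < lo
  lo_le_hi : lo ≤ hi
  ω_pos : 0 < ω
  ω_le : ω ≤ hi
  noise_nonneg : 0 ≤ noise
  card_le : Sstar.card ≤ d
  n_pos : 0 < n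
  eig : SparseEigenvalues X n lo hi (2 * d + 1)
  noise_le : ∀ S ⊆ A, S.card ≤ d → ∀ k ∈ A,
    ((X.col j - X *ᵥ β) ⬝ᵥ residual X S (X.col k)) ^ 2 ≤
      ω * noise * (residual X S (X.col k) ⬝ᵥ residual X S (X.col k))
  le_rss : ∀ S ⊆ A, S.card ≤ d → n * ω / 2 ≤ rss X j S
  beta_min : ∀ i ∈ Sstar, b ≤ β i ^ 2

namespace NodeModel

variable {A Sstar : Finset (Fin p)} {β : Fin p → ℝ} {ω lo hi noise b : ℝ} {d : ℕ}

theorem hi_pos (h : NodeModel X j A Sstar β ω lo hi noise b d) : 0 < hi :=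
  h.lo_pos.trans_le h.lo_le_hi

theorem cast_pos (h : NodeModel X j A Sstar β ω lo hi noise b d) : (0 : ℝ) < n := by
  exact_mod_cast h.n_pos

theorem fullRankOn (h : NodeModel X j A Sstar β ω lo hi noise b d) {S : Finset (Fin p)}
    (hS : S.card ≤ 2 * d + 1) : FullRankOn X S :=
  h.eig.fullRankOn h.cast_pos h.lo_pos hS

theorem rss_pos (h : NodeModel X j A Sstar β ω lo hi noise b d) {S : Finset (Fin p)}
    (hSA : S ⊆ A) (hS : S.card ≤ d) : 0 < rss X j S := by
  have := h.le_rss S hSA hS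
  have h1 := h.cast_pos
  have h2 := h.ω_pos
  exact lt_of_lt_of_le (by positivity) this

theorem rss_le (h : NodeModel X j A Sstar β ω lo hi noise b d) {S : Finset (Fin p)}
    (hS : S.card ≤ d) : rss X j S ≤ n * hi := by
  have hf := h.fullRankOn (S := S) (by omega)
  rw [rss_eq_dotProduct_self hf]
  exact (residual_dotProduct_self_le hf _).trans (h.eig.col_dotProduct_le (by omega) j)

/-- Only the part of the signal outside `S` matters for residuals on `S`. -/
theorem signal_eq {S : Finset (Fin p)} (hf : FullRankOn X S)
    (hβ : ∀ i ∉ Sstar, β i = 0) {T : Finset (Fin p)} (hT : Sstar \ S ⊆ T) (y : Fin n → ℝ) :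
    (X *ᵥ β) ⬝ᵥ residual X S y =
      (X *ᵥ fun i => if i ∈ T then β i else 0) ⬝ᵥ residual X S y := by
  rw [← sub_eq_zero, ← sub_dotProduct, ← Matrix.mulVec_sub]
  refine mulVec_dotProduct_residual hf y fun i hi => ?_
  by_cases h1 : i ∈ T
  · simp [h1]
  · have : i ∉ Sstar := fun hs => h1 (hT (Finset.mem_sdiff.2 ⟨hs, hi⟩))
    simp [h1, hβ i this]

theorem card_mul_le {T : Finset (Fin p)} (hT : ∀ i ∈ T, b ≤ β i ^ 2) :
    T.card * b ≤ (fun i => if i ∈ T then β i else 0) ⬝ᵥ (fun i => if i ∈ T then β i else 0) := by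
  simp only [dotProduct, ← pow_two]
  calc T.card * b = ∑ i ∈ T, b := by simp
    _ ≤ ∑ i ∈ T, (if i ∈ T then β i else 0) ^ 2 :=
        Finset.sum_le_sum fun i hi => by simpa [hi] using hT i hi
    _ ≤ _ := Finset.sum_le_sum_of_subset_of_nonneg (Finset.subset_univ T) fun _ _ _ => sq_nonneg _

/-- The true parents survive the deletion, so the signal is orthogonal to the residual of `X_l` and
only noise is projected. -/
theorem rss_delete_le (h : NodeModel X j A Sstar β ω lo hi noise b d) {S : Finset (Fin p)}
    (hSA : S ⊆ A) (hS : S.card ≤ d) {l : Fin p} (hl : l ∈ S) (hsub : Sstar ⊆ S.erase l) :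
    rss X j (S.erase l) - rss X j S ≤ ω * noise := by
  have hf := h.fullRankOn (S := S) (by omega)
  have hE : FullRankOn X (S.erase l) := hf.mono (Finset.erase_subset l S)
  have hins : insert l (S.erase l) = S := Finset.insert_erase hl
  have h1 := rss_sub_rss_insert (X := X) (Finset.notMem_erase l S) (by rwa [hins]) j
  rw [hins] at h1
  have hpos := residual_col_dotProduct_self_pos (X := X) (Finset.notMem_erase l S) (by rwa [hins])
  rw [h1, div_le_iff₀ hpos]
  have h2 := h.noise_le (S.erase l) ((Finset.erase_subset l S).trans hSA)
    ((Finset.card_le_card (Finset.erase_subset l S)).trans hS) l (hSA hl)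
  rwa [sub_dotProduct, mulVec_dotProduct_residual hE _
    (fun i hi => h.support i fun hc => hi (hsub hc)), sub_zero] at h2

/-- The share of the omitted signal that the best missing regressor explains. -/
def share (n : ℕ) (lo hi : ℝ) (T : Finset (Fin p)) (β : Fin p → ℝ) : ℝ :=
  n * lo ^ 2 *
    ((fun i => if i ∈ T then β i else 0) ⬝ᵥ (fun i => if i ∈ T then β i else 0)) / (hi * T.card)

theorem exists_rss_add_le (h : NodeModel X j A Sstar β ω lo hi noise b d) {S : Finset (Fin p)}
    (hSA : S ⊆ A) (hS : S.card ≤ d) (hsub : ¬ Sstar ⊆ S) :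
    ∃ k ∈ Sstar \ S, share n lo hi (Sstar \ S) β / 2 - hi * noise ≤
      rss X j S - rss X j (insert k S) := by
  have hT : (Sstar \ S).Nonempty := Finset.sdiff_nonempty.2 hsub
  have hcard : (S ∪ Sstar \ S).card ≤ 2 * d + 1 := by
    have := Finset.card_union_le S (Sstar \ S)
    have h2 := Finset.card_le_card (Finset.sdiff_subset (s := Sstar) (t := S))
    have := h.card_le
    omega
  obtain ⟨k, hk, hle⟩ := exists_strong_signal h.eig h.cast_pos h.lo_pos h.hi_pos
    Finset.disjoint_sdiff hT hcard (β := fun i => if i ∈ Sstar \ S then β i else 0)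
    (fun i hi => if_neg hi)
  refine ⟨k, hk, ?_⟩
  have hkS : k ∉ S := (Finset.mem_sdiff.1 hk).2
  have hkA : k ∈ A := h.subset (Finset.mem_sdiff.1 hk).1
  have hfS := h.fullRankOn (S := S) (by omega)
  have hfi : FullRankOn X (insert k S) :=
    h.fullRankOn ((Finset.card_insert_le _ _).trans (by omega))
  have hpos := residual_col_dotProduct_self_pos hkS hfi
  rw [rss_sub_rss_insert hkS hfi, le_div_iff₀ hpos]
  rw [← signal_eq hfS h.support subset_rfl] at hle
  have hno := h.noise_le S hSA hS k hkA
  rw [sub_dotProduct] at hno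
  set q := residual X S (X.col k) ⬝ᵥ residual X S (X.col k) with hq
  set x := (X *ᵥ β) ⬝ᵥ residual X S (X.col k) with hx
  set z := X.col j ⬝ᵥ residual X S (X.col k) with hz
  have hTpos : (0 : ℝ) < (Sstar \ S).card := by exact_mod_cast Finset.card_pos.2 hT
  have h1 : share n lo hi (Sstar \ S) β * q ≤ x ^ 2 := by
    have := h.hi_pos
    rw [share, div_mul_eq_mul_div, div_le_iff₀ (by positivity)]
    linarith
  have h2 : ω * noise * q ≤ hi * noise * q := by
    have := h.noise_nonneg
    have := h.ω_le
    gcongr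
  -- Projection `z` and signal `x` satisfy z² ≥ x²/2 - (z - x)², which is where half of the share
  -- survives.
  nlinarith [sq_nonneg (2 * z - x)]

/-- The second half of a swap. The loss is an eighth of the share, against the half gained by the
addition of `k`. -/
theorem exists_rss_remove_le (h : NodeModel X j A Sstar β ω lo hi noise b d)
    {S : Finset (Fin p)} (hSA : S ⊆ A) (hS : S.card = d) {k : Fin p}
    (hk : k ∈ Sstar \ S)
    (hR : 4 * hi ^ 2 * (lo ^ 4)⁻¹ * (hi - lo) ^ 2 * (Sstar \ S).card ≤ (S \ Sstar).card)
    (hRne : (S \ Sstar).Nonempty) :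
    ∃ l ∈ S \ Sstar, rss X j ((insert k S).erase l) - rss X j (insert k S) ≤
      share n lo hi (Sstar \ S) β / 8 + 2 * hi * noise := by
  have hkS : k ∉ S := (Finset.mem_sdiff.1 hk).2
  have hkA : k ∈ A := h.subset (Finset.mem_sdiff.1 hk).1
  have hlo := h.lo_pos
  have hhi := h.hi_pos
  -- The `d + 1` elements present after the addition, with at most `d` missing ones, account for the
  -- `2 * d + 1` in `eig`.
  have hcard : (insert k S ∪ Sstar \ insert k S).card ≤ 2 * d + 1 := by
    have := Finset.card_union_le (insert k S) (Sstar \ insert k S)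
    have h2 := Finset.card_le_card (Finset.sdiff_subset (s := Sstar) (t := insert k S))
    have := Finset.card_insert_le k S
    have := h.card_le
    omega
  obtain ⟨l, hl, hle⟩ := exists_weak_signal (R := S \ Sstar) h.eig h.cast_pos hlo h.lo_le_hi
    Finset.disjoint_sdiff (Finset.sdiff_subset.trans (Finset.subset_insert k S)) hRne hcard
    (β := fun i => if i ∈ Sstar \ insert k S then β i else 0) (fun i hi => if_neg hi)
  refine ⟨l, hl, ?_⟩
  have hlS : l ∈ S := (Finset.mem_sdiff.1 hl).1
  have hli : l ∈ insert k S := Finset.mem_insert_of_mem hlS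
  have hkl : k ≠ l := fun e => hkS (e ▸ hlS)
  have hfi : FullRankOn X (insert k S) :=
    h.fullRankOn ((Finset.card_insert_le _ _).trans (by omega))
  have hins : insert l ((insert k S).erase l) = insert k S := Finset.insert_erase hli
  have hpos := residual_col_dotProduct_self_pos (X := X)
    (Finset.notMem_erase l (insert k S)) (by rwa [hins])
  have h1 := rss_sub_rss_insert (X := X) (Finset.notMem_erase l (insert k S)) (by rwa [hins]) j
  rw [hins] at h1
  have hfe : FullRankOn X ((insert k S).erase l) := hfi.mono (Finset.erase_subset l _)
  have hecard : ((insert k S).erase l).card ≤ d := by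
    rw [Finset.card_erase_of_mem hli, Finset.card_insert_of_notMem hkS]; omega
  rw [h1, div_le_iff₀ hpos]
  have hno := h.noise_le ((insert k S).erase l)
    ((Finset.erase_subset l _).trans (Finset.insert_subset hkA hSA)) hecard l (hSA hlS)
  rw [sub_dotProduct] at hno
  -- The deleted regressor is not a true parent, so its deletion omits no further signal.
  have hTsub : Sstar \ (insert k S).erase l ⊆ Sstar \ insert k S := by
    intro i hi
    simp only [Finset.mem_sdiff, Finset.mem_erase] at hi ⊢
    refine ⟨hi.1, fun hc => hi.2 ⟨?_, hc⟩⟩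
    rintro rfl
    exact (Finset.mem_sdiff.1 hl).2 hi.1
  rw [← signal_eq hfe h.support hTsub] at hle
  set u := residual X ((insert k S).erase l) (X.col l) with hu
  set q := u ⬝ᵥ u with hq
  set x := (X *ᵥ β) ⬝ᵥ u with hx
  set z := X.col j ⬝ᵥ u with hz
  have hββ : (fun i => if i ∈ Sstar \ insert k S then β i else 0) ⬝ᵥ
      (fun i => if i ∈ Sstar \ insert k S then β i else 0) ≤
      (fun i => if i ∈ Sstar \ S then β i else 0) ⬝ᵥ
        (fun i => if i ∈ Sstar \ S then β i else 0) := by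
    refine Finset.sum_le_sum fun i _ => ?_
    by_cases h2 : i ∈ Sstar \ insert k S
    · have h3 : i ∈ Sstar \ S := Finset.sdiff_subset_sdiff subset_rfl (Finset.subset_insert k S) h2
      simp only [h2, h3, if_true]; exact le_rfl
    · simp only [h2, if_false, mul_zero]; exact mul_self_nonneg _
  set B := (fun i => if i ∈ Sstar \ S then β i else 0) ⬝ᵥ
        (fun i => if i ∈ Sstar \ S then β i else 0) with hB
  have hB0 : 0 ≤ B := dotProduct_self_nonneg' _
  have hRpos : (0 : ℝ) < (S \ Sstar).card := by exact_mod_cast Finset.card_pos.2 hRne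
  have hTpos : (0 : ℝ) < (Sstar \ S).card := by exact_mod_cast Finset.card_pos.2 ⟨k, hk⟩
  have hn := h.cast_pos
  -- The source of ν₀: the weak signal is divided by |R| and the share by |T|, and `hR` compares the
  -- two counts with exactly the constant needed for 16.
  have hx2 : 16 * x ^ 2 ≤ share n lo hi (Sstar \ S) β * q := by
    have h5 : 4 * lo ^ 2 * (S \ Sstar).card * x ^ 2 ≤ n * hi * (hi - lo) ^ 2 * B * q := by
      refine hle.trans ?_
      gcongr
    have h6 : 4 * hi ^ 2 * (hi - lo) ^ 2 * (Sstar \ S).card ≤ lo ^ 4 * (S \ Sstar).card := by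
      have : 4 * hi ^ 2 * (lo ^ 4)⁻¹ * (hi - lo) ^ 2 * (Sstar \ S).card =
        4 * hi ^ 2 * (hi - lo) ^ 2 * (Sstar \ S).card / lo ^ 4 := by ring
      rw [this, div_le_iff₀ (by positivity)] at hR
      linarith
    rw [share, ← hB, div_mul_eq_mul_div, le_div_iff₀ (by positivity)]
    refine le_of_mul_le_mul_left ?_ (show 0 < lo ^ 2 * (S \ Sstar).card by positivity)
    calc lo ^ 2 * (S \ Sstar).card * (16 * x ^ 2 * (hi * (Sstar \ S).card))
        = 4 * hi * (Sstar \ S).card * (4 * lo ^ 2 * (S \ Sstar).card * x ^ 2) := by ring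
      _ ≤ 4 * hi * (Sstar \ S).card * (n * hi * (hi - lo) ^ 2 * B * q) := by gcongr
      _ = (4 * hi ^ 2 * (hi - lo) ^ 2 * (Sstar \ S).card) * (n * B * q) := by ring
      _ ≤ (lo ^ 4 * (S \ Sstar).card) * (n * B * q) := by gcongr
      _ = _ := by ring
  have h2 : ω * noise * q ≤ hi * noise * q := by
    have := h.noise_nonneg
    have := h.ω_le
    gcongr
  -- Here z² ≤ 2x² + 2(z - x)².
  nlinarith [sq_nonneg (z - 2 * x)]

end NodeModel

end Moves

/-! ### The gain of the optimal move -/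

section Gain

variable {n p : ℕ} {X : Matrix (Fin n) (Fin p) ℝ} {j : Fin p}
  {A Sstar : Finset (Fin p)} {β : Fin p → ℝ} {ω lo hi : ℝ} {d : ℕ}

/-- The minimal squared edge weight. -/
def betaMin (H : Hyper) (Cβ lo hi L : ℝ) (n : ℕ) : ℝ :=
  5 * (Cβ + 4 * H.c₂) * (hi ^ 2 * L / (H.α * lo ^ 2 * n))

/-- Each missing parent contributes at least `betaMin` and the share is an average over `T`, so |T|
cancels and the bound does not depend on how many parents are missing. -/
theorem le_share {H : Hyper} {Cβ L : ℝ} {T : Finset (Fin p)} (hT : T.Nonempty)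
    (hα : 0 < H.α) (hlo : 0 < lo) (hhi : 0 < hi) (hn : 0 < n)
    (hb : ∀ i ∈ T, betaMin H Cβ lo hi L n ≤ β i ^ 2) :
    5 * ((Cβ + 4 * H.c₂) / H.α) * L * hi ≤ NodeModel.share n lo hi T β := by
  have hn' : (0 : ℝ) < n := by exact_mod_cast hn
  have hTpos : (0 : ℝ) < T.card := by exact_mod_cast Finset.card_pos.2 hT
  have h1 := NodeModel.card_mul_le hb
  rw [NodeModel.share, le_div_iff₀ (by positivity)]
  calc 5 * ((Cβ + 4 * H.c₂) / H.α) * L * hi * (hi * T.card)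
      = n * lo ^ 2 * (T.card * betaMin H Cβ lo hi L n) := by
        rw [betaMin]; field_simp
    _ ≤ _ := by gcongr

/-- The bookkeeping of constants. The noise level is `ρ * L`, the share is at least `5 * a * L *
hi`, and `a ≥ 4 * ρ` because `c₂` dominates `α * ρ`; so signal outweighs noise in every underfitted
case. -/
theorem transition_gain {H : Hyper} {Cβ L t ds : ℝ}
    (h : NodeModel X j A Sstar β ω lo hi ((4 * d + 6) * L) (betaMin H Cβ lo hi L n) d)
    (hα : 0 < H.α ∧ H.α < 1) (hκ : 0 ≤ H.κ) (hκn : H.κ ≤ n) (hL : 0 ≤ L)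
    (hH : 0 < H.c₁ * (p : ℝ) ^ H.c₂ * √(1 + H.α / H.γ))
    (hpen : H.c₂ * L ≤ penalty H p ∧ penalty H p ≤ (H.c₂ + 1) * L)
    (ht : 0 < t) (hc₂ : (H.α + 1) * (4 * d + 6) + t ≤ H.c₂) (hCβ : 0 < Cβ)
    (hDP : (4 * hi ^ 2 * (lo ^ 4)⁻¹ * (hi - lo) ^ 2 + 1) * ds ≤ d) (hds : Sstar.card ≤ ds)
    {S : Finset (Fin p)} (hSA : S ⊆ A) (hS : S.card ≤ d) (hne : S ≠ Sstar) :
    t * L ≤ nodeScore H X j (transition (nodeScore H X j) d Sstar S) - nodeScore H X j S := by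
  have hlo := h.lo_pos
  have hhi := h.hi_pos
  set ρ : ℝ := 4 * d + 6 with hρ
  have hρ0 : 6 ≤ ρ := by rw [hρ]; have : (0 : ℝ) ≤ d := Nat.cast_nonneg d; linarith
  have hαρ : 0 < H.α * ρ := mul_pos hα.1 (by linarith)
  set a := (Cβ + 4 * H.c₂) / H.α with ha
  have hαa : H.α * a = Cβ + 4 * H.c₂ := by rw [ha]; field_simp [hα.1.ne']
  have haρ : 4 * ρ ≤ a := by
    refine le_of_mul_le_mul_left ?_ hα.1
    rw [hαa]; linarith
  rw [transition, if_neg hne]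
  split_ifs with hsub hR hcard hT hTR
  -- Deleting any redundant regressor gains enough, so the bound is proved for the maximizer itself;
  -- additions and swaps instead compare it with one good choice.
  · refine le_trans ?_ (sub_le_sub_right (le_argmax (fun l => nodeScore H X j (S \ {l})) _ hR
      (argmax_mem (fun l => nodeScore H X j (S \ {l})) _ hR)) _)
    set l := argmax (fun l => nodeScore H X j (S \ {l})) _ hR with hl
    have hlR : l ∈ S \ Sstar := argmax_mem _ _ hR
    have hlS := (Finset.mem_sdiff.1 hlR).1
    have h1 : Sstar ⊆ S.erase l := fun i hi =>
      Finset.mem_erase.2 ⟨fun e => (Finset.mem_sdiff.1 hlR).2 (e ▸ hi), hsub hi⟩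
    refine nodeScore_delete hlS (ω := ω) (ρ := ρ) hH h.n_pos hα.1.le hκ hκn h.ω_pos
      (by positivity) hpen.1 hL hc₂ (h.le_rss S hSA hS) ?_ ?_
    · exact h.rss_pos (Finset.sdiff_subset.trans hSA)
        ((Finset.card_le_card Finset.sdiff_subset).trans hS)
    · rw [Finset.sdiff_singleton_eq_erase]
      exact h.rss_delete_le hSA hS hlS h1
  · exact absurd (Finset.Subset.antisymm (Finset.sdiff_eq_empty_iff_subset.1
      (Finset.not_nonempty_iff_eq_empty.1 hR)) hsub) hne
  · obtain ⟨k, hk, hle⟩ := h.exists_rss_add_le hSA hS hsub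
    refine le_trans ?_ (sub_le_sub_right
      (le_argmax (fun k => nodeScore H X j (S ∪ {k})) _ hT hk) _)
    have hkS := (Finset.mem_sdiff.1 hk).2
    have hkA := h.subset (Finset.mem_sdiff.1 hk).1
    have hsh := le_share (Cβ := Cβ) (H := H) (L := L) hT hα.1 hlo hhi h.n_pos
      fun i hi => h.beta_min i (Finset.mem_sdiff.1 hi).1
    have e : S ∪ {k} = insert k S := by rw [Finset.union_comm, Finset.insert_eq]
    have hci : (insert k S).card ≤ d := by rw [Finset.card_insert_of_notMem hkS]; omega
    -- Half of the share, 5a/2, minus the noise ρ. It must pay the penalty for one extra regressor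
    -- on top of `t * L`.
    refine nodeScore_add hkS (hi := hi) (y := (5 / 2 * a - ρ) * L) hH h.n_pos hα.1.le hκ hhi
      (mul_nonneg (by linarith) hL) hpen.2 (h.rss_pos hSA hS)
      (e ▸ h.rss_pos (Finset.insert_subset hkA hSA) hci) (h.rss_le hS) ?_ ?_
    · rw [e]
      refine le_trans ?_ hle
      linarith
    · have : H.α * ((5 / 2 * a - ρ) * L) / 2 = (5 / 4 * (H.α * a) - H.α * ρ / 2) * L := by ring
      rw [this, hαa]
      gcongr
      linarith
  · exact absurd (Finset.sdiff_nonempty.2 hsub) hT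
  · have hSd : S.card = d := by omega
    have hT : (Sstar \ S).Nonempty := Finset.sdiff_nonempty.2 hsub
    have hRne : (S \ Sstar).Nonempty := (Finset.nonempty_product.1 hTR).2
    obtain ⟨k, hk, hle⟩ := h.exists_rss_add_le hSA hS hsub
    have hkS := (Finset.mem_sdiff.1 hk).2
    have hkA := h.subset (Finset.mem_sdiff.1 hk).1
    have hν0 : 0 ≤ 4 * hi ^ 2 * (lo ^ 4)⁻¹ * (hi - lo) ^ 2 := by positivity
    -- A full set has |R| = d - |S ∩ S*| ≥ d - d*, and DP makes this at least ν₀ d* ≥ ν₀ |T|.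
    have hRT : 4 * hi ^ 2 * (lo ^ 4)⁻¹ * (hi - lo) ^ 2 * (Sstar \ S).card ≤ (S \ Sstar).card := by
      have h1 : ((S \ Sstar).card : ℝ) + (S ∩ Sstar).card = d := by
        rw [← hSd]; exact_mod_cast Finset.card_sdiff_add_card_inter S Sstar
      have h2 : ((Sstar \ S).card : ℝ) + (Sstar ∩ S).card = Sstar.card := by
        exact_mod_cast Finset.card_sdiff_add_card_inter Sstar S
      rw [Finset.inter_comm] at h2
      have h3 : ((Sstar \ S).card : ℝ) ≤ ds := by
        have : (0 : ℝ) ≤ (S ∩ Sstar).card := Nat.cast_nonneg _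
        linarith
      have h4 := mul_le_mul_of_nonneg_left h3 hν0
      have h5 : (0 : ℝ) ≤ (Sstar \ S).card := Nat.cast_nonneg _
      linarith
    obtain ⟨l, hl, hle2⟩ := h.exists_rss_remove_le hSA hSd hk hRT hRne
    refine le_trans ?_ (sub_le_sub_right
      (le_argmax (fun kl : Fin p × Fin p => nodeScore H X j ((S ∪ {kl.1}) \ {kl.2})) _ hTR
        (Finset.mk_mem_product hk hl)) _)
    have hlS := (Finset.mem_sdiff.1 hl).1
    have hsh := le_share (Cβ := Cβ) (H := H) (L := L) hT hα.1 hlo hhi h.n_pos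
      fun i hi => h.beta_min i (Finset.mem_sdiff.1 hi).1
    have e : (S ∪ {k}) \ {l} = (insert k S).erase l := by
      rw [Finset.union_comm, ← Finset.insert_eq, Finset.sdiff_singleton_eq_erase]
    dsimp only
    rw [e]
    have hc : ((insert k S).erase l).card = S.card := by
      rw [Finset.card_erase_of_mem (Finset.mem_insert_of_mem hlS),
        Finset.card_insert_of_notMem hkS]; omega
    -- The net drop is (1/2 - 1/8) of the share, that is 15a/8, minus one noise term from the
    -- addition and two from the deletion. The penalty is unchanged.
    refine nodeScore_swap (hi := hi) (y := (15 / 8 * a - 3 * ρ) * L) hc hH h.n_pos hα.1.le hκ hhi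
      (mul_nonneg (by linarith) hL) (h.rss_pos hSA hS)
      (h.rss_pos ((Finset.erase_subset _ _).trans (Finset.insert_subset hkA hSA)) (hc ▸ hS))
      (h.rss_le hS) ?_ ?_
    · linarith
    · have : H.α * ((15 / 8 * a - 3 * ρ) * L) / 2 =
        (15 / 16 * (H.α * a) - 3 / 2 * (H.α * ρ)) * L := by ring
      rw [this, hαa]
      gcongr
      linarith
  -- With no swap available, `S` lies inside the true set; having the maximal size `d`, it equals
  -- it.
  · have hSd : S.card = d := by omega
    have hT : (Sstar \ S).Nonempty := Finset.sdiff_nonempty.2 hsub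
    refine absurd (Finset.nonempty_product.2 ⟨hT, ?_⟩) hTR
    refine Finset.sdiff_nonempty.2 fun hc => hne ?_
    exact Finset.eq_of_subset_of_card_le hc (by have := h.card_le; omega)

end Gain

/-! ### From gains along moves to posterior concentration -/

section Concentration

variable {p : ℕ}

theorem transition_subset {ψ : Finset (Fin p) → ℝ} {d : ℕ} {A Sstar S : Finset (Fin p)}
    (hstar : Sstar ⊆ A) (hS : S ⊆ A) : transition ψ d Sstar S ⊆ A := by
  rw [transition]
  split_ifs with h1 h2 h3 h4 h5 h6
  · exact hstar
  · exact Finset.sdiff_subset.trans hS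
  · exact hS
  · exact Finset.union_subset hS (Finset.singleton_subset_iff.2
      (hstar (Finset.mem_sdiff.1 (argmax_mem _ _ h5)).1))
  · exact hS
  · exact Finset.sdiff_subset.trans (Finset.union_subset hS (Finset.singleton_subset_iff.2
      (hstar (Finset.mem_sdiff.1 (Finset.mem_product.1 (argmax_mem _ _ h6)).1).1)))
  · exact hS

theorem card_transition_le {ψ : Finset (Fin p) → ℝ} {d : ℕ} {Sstar S : Finset (Fin p)}
    (hstar : Sstar.card ≤ d) (hS : S.card ≤ d) : (transition ψ d Sstar S).card ≤ d := by
  rw [transition]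
  split_ifs with h1 h2 h3 h4 h5 h6
  · exact hstar
  · exact (Finset.card_le_card Finset.sdiff_subset).trans hS
  · exact hS
  · refine (Finset.card_union_le _ _).trans ?_
    rw [Finset.card_singleton]; omega
  · exact hS
  · set kl := argmax (fun kl : Fin p × Fin p => ψ ((S ∪ {kl.1}) \ {kl.2}))
          ((Sstar \ S) ×ˢ (S \ Sstar)) h6 with hkl
    have hm := Finset.mem_product.1 (argmax_mem (fun kl : Fin p × Fin p =>
      ψ ((S ∪ {kl.1}) \ {kl.2})) _ h6)
    rw [← hkl] at hm
    have hl : kl.2 ∈ S ∪ {kl.1} := Finset.mem_union_left _ (Finset.mem_sdiff.1 hm.2).1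
    rw [Finset.card_sdiff_of_subset (Finset.singleton_subset_iff.2 hl), Finset.card_singleton]
    have := Finset.card_union_le S {kl.1}
    rw [Finset.card_singleton] at this
    omega
  · exact hS

/-- A set differs from its image under a move in at most two elements. -/
theorem exists_eq_symmDiff_transition (ψ : Finset (Fin p) → ℝ) (d : ℕ) (Sstar S : Finset (Fin p))
    (hne : S ≠ Sstar) (hcard : Sstar.card ≤ d) (hS : S.card ≤ d) :
    ∃ a b : Fin p, S = symmDiff (transition ψ d Sstar S) {a, b} := by
  rw [transition, if_neg hne]
  split_ifs with h2 h3 h4 h5 h6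
  · have hm := Finset.mem_sdiff.1 (argmax_mem (fun l => ψ (S \ {l})) _ h3)
    -- Taking `a = b` makes the pair a singleton, so moves of one element are coded by the same p²
    -- pairs as swaps.
    refine ⟨argmax (fun l => ψ (S \ {l})) _ h3, argmax (fun l => ψ (S \ {l})) _ h3, ?_⟩
    ext i
    simp only [Finset.mem_symmDiff, Finset.mem_sdiff, Finset.mem_insert, Finset.mem_singleton]
    by_cases hi : i = argmax (fun l => ψ (S \ {l})) _ h3
    · simp [hi, hm.1]
    · simp [hi]
  · exact absurd (Finset.Subset.antisymm (Finset.sdiff_eq_empty_iff_subset.1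
      (Finset.not_nonempty_iff_eq_empty.1 h3)) h2) hne
  · have hm := Finset.mem_sdiff.1 (argmax_mem (fun k => ψ (S ∪ {k})) _ h5)
    set k := argmax (fun k => ψ (S ∪ {k})) _ h5
    refine ⟨k, k, ?_⟩
    ext i
    simp only [Finset.mem_symmDiff, Finset.mem_union, Finset.mem_insert, Finset.mem_singleton]
    by_cases hi : i = k
    · simp [hi, hm.2]
    · simp [hi]
  · exact absurd (Finset.sdiff_nonempty.2 h2) h5
  · set kl := argmax (fun kl : Fin p × Fin p => ψ ((S ∪ {kl.1}) \ {kl.2}))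
          ((Sstar \ S) ×ˢ (S \ Sstar)) h6 with hkl
    have hm := Finset.mem_product.1 (argmax_mem (fun kl : Fin p × Fin p =>
      ψ ((S ∪ {kl.1}) \ {kl.2})) _ h6)
    rw [← hkl] at hm
    have hk := Finset.mem_sdiff.1 hm.1
    have hl := Finset.mem_sdiff.1 hm.2
    refine ⟨kl.1, kl.2, ?_⟩
    ext i
    simp only [Finset.mem_symmDiff, Finset.mem_union, Finset.mem_sdiff, Finset.mem_insert,
      Finset.mem_singleton]
    by_cases hi : i = kl.1
    · have : kl.1 ≠ kl.2 := fun e => hk.2 (e ▸ hl.1)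
      simp [hi, hk.2, this]
    · by_cases hi2 : i = kl.2
      · simp [hi2, hl.1]
      · simp [hi, hi2]
  · refine absurd (Finset.nonempty_product.2 ⟨Finset.sdiff_nonempty.2 h2, ?_⟩) h6
    refine Finset.sdiff_nonempty.2 fun hc => hne ?_
    exact Finset.eq_of_subset_of_card_le hc (by omega)

theorem mem_candidates {σ : Equiv.Perm (Fin p)} {j : Fin p} {d : ℕ} {S : Finset (Fin p)} :
    S ∈ candidates σ j d ↔ S ⊆ predecessors σ j ∧ S.card ≤ d := by
  simp [candidates]

/-- The sum over the false sets is compared with the sum of the weights of their images. A fibre of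
the transition has at most p² elements, since S is recovered from its image and a pair; the images
range over all candidates, so no iteration is needed. -/
theorem posterior_node_concentration {ψ : Finset (Fin p) → ℝ} {d : ℕ} {σ : Equiv.Perm (Fin p)}
    {j : Fin p} {Sstar : Finset (Fin p)} {t : ℝ} (hp : 1 ≤ p)
    (hstar : Sstar ∈ candidates σ j d)
    (hgain : ∀ S ∈ candidates σ j d, S ≠ Sstar →
      t * Real.log p ≤ ψ (transition ψ d Sstar S) - ψ S) :
    (1 - (p : ℝ) ^ (-(t - 2))) * ∑ S ∈ candidates σ j d, Real.exp (ψ S) ≤ Real.exp (ψ Sstar) := by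
  classical
  have hp0 : (0 : ℝ) < p := by exact_mod_cast hp
  set C := candidates σ j d with hC
  set g := transition ψ d Sstar with hg
  have hstar' := mem_candidates.1 hstar
  have hgC : ∀ S ∈ C, g S ∈ C := fun S hS => mem_candidates.2
    ⟨transition_subset hstar'.1 (mem_candidates.1 hS).1,
      card_transition_le hstar'.2 (mem_candidates.1 hS).2⟩
  have hexp : ∀ S ∈ C.erase Sstar, Real.exp (ψ S) ≤ (p : ℝ) ^ (-t) * Real.exp (ψ (g S)) := by
    intro S hS
    have h1 := hgain S (Finset.mem_of_mem_erase hS) (Finset.ne_of_mem_erase hS)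
    rw [Real.rpow_def_of_pos hp0, ← Real.exp_add]
    refine Real.exp_le_exp.2 ?_
    linarith
  have hfib : ∑ S ∈ C.erase Sstar, Real.exp (ψ (g S)) ≤
      (p : ℝ) ^ 2 * ∑ S ∈ C, Real.exp (ψ S) := by
    rw [← Finset.sum_fiberwise_of_maps_to (s := C.erase Sstar) (t := C) (g := g)
      fun S hS => hgC S (Finset.mem_of_mem_erase hS), Finset.mul_sum]
    refine Finset.sum_le_sum fun S' _ => ?_
    rw [Finset.sum_congr rfl fun S hS => by rw [(Finset.mem_filter.1 hS).2],
      Finset.sum_const, nsmul_eq_mul]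
    refine mul_le_mul_of_nonneg_right ?_ (Real.exp_pos _).le
    have : ((C.erase Sstar).filter fun S => g S = S') ⊆
        (Finset.univ : Finset (Fin p × Fin p)).image fun ab => symmDiff S' {ab.1, ab.2} := by
      intro S hS
      have h1 := Finset.mem_filter.1 hS
      have h2 := Finset.mem_of_mem_erase h1.1
      obtain ⟨a, b, hab⟩ := exists_eq_symmDiff_transition ψ d Sstar S
        (Finset.ne_of_mem_erase h1.1) hstar'.2 (mem_candidates.1 h2).2
      refine Finset.mem_image.2 ⟨(a, b), Finset.mem_univ _, ?_⟩
      rw [← h1.2]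
      exact hab.symm
    have h3 := (Finset.card_le_card this).trans Finset.card_image_le
    rw [Finset.card_univ, Fintype.card_prod, Fintype.card_fin] at h3
    rw [pow_two]
    exact_mod_cast h3
  have hsplit := Finset.add_sum_erase C (fun S => Real.exp (ψ S)) hstar
  have h4 : ∑ S ∈ C.erase Sstar, Real.exp (ψ S) ≤
      (p : ℝ) ^ (-(t - 2)) * ∑ S ∈ C, Real.exp (ψ S) := by
    calc _ ≤ ∑ S ∈ C.erase Sstar, (p : ℝ) ^ (-t) * Real.exp (ψ (g S)) := Finset.sum_le_sum hexp
      _ = (p : ℝ) ^ (-t) * ∑ S ∈ C.erase Sstar, Real.exp (ψ (g S)) := by rw [Finset.mul_sum]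
      _ ≤ (p : ℝ) ^ (-t) * ((p : ℝ) ^ 2 * ∑ S ∈ C, Real.exp (ψ S)) := by gcongr
      _ = _ := by
        rw [← mul_assoc, ← Real.rpow_natCast, ← Real.rpow_add hp0]
        congr 2
        push_cast
        ring
  linarith

/-- A DAG is determined by its parent sets, so dropping acyclicity and the out-degree bound enlarges
the sum to a product over nodes. Bernoulli's inequality then collects the p factors 1 - x. -/
theorem posterior_dag_concentration {f : Fin p → Finset (Fin p) → ℝ} {d dout : ℕ}
    {σ : Equiv.Perm (Fin p)} {Sstar : Fin p → Finset (Fin p)} {x : ℝ} (hx : x ≤ 1)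
    (hnode : ∀ j, (1 - x) * ∑ S ∈ candidates σ j d, Real.exp (f j S) ≤
      Real.exp (f j (Sstar j))) :
    (1 - p * x) * ∑ G ∈ sparseDAGs σ d dout, Real.exp (∑ j, f j (G.parents j)) ≤
      Real.exp (∑ j, f j (Sstar j)) := by
  classical
  have h1 : ∑ G ∈ sparseDAGs σ d dout, Real.exp (∑ j, f j (G.parents j)) ≤
      ∏ j, ∑ S ∈ candidates σ j d, Real.exp (f j S) := by
    rw [Finset.prod_univ_sum]
    have hinj : Set.InjOn (fun G : DAG p => G.parents) (sparseDAGs σ d dout : Set (DAG p)) := by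
      intro G _ G' _ h
      refine DAG.ext (Finset.ext fun e => ?_)
      have := congrArg (fun s => e.1 ∈ s) (congrFun h e.2)
      simpa [DAG.parents] using this
    calc ∑ G ∈ sparseDAGs σ d dout, Real.exp (∑ j, f j (G.parents j))
        = ∑ S ∈ (sparseDAGs σ d dout).image (fun G => G.parents), ∏ j, Real.exp (f j (S j)) := by
          rw [Finset.sum_image hinj]
          exact Finset.sum_congr rfl fun G _ => Real.exp_sum _ _
      _ ≤ _ := by
          refine Finset.sum_le_sum_of_subset_of_nonneg ?_ fun _ _ _ =>
            Finset.prod_nonneg fun _ _ => (Real.exp_pos _).le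
          intro S hS
          obtain ⟨G, hG, rfl⟩ := Finset.mem_image.1 hS
          have hG' := (Finset.mem_filter.1 hG).2
          refine Fintype.mem_piFinset.2 fun j => mem_candidates.2 ⟨fun i hi => ?_, hG'.2.1 j⟩
          have hij : (i, j) ∈ G.edges := by simpa [DAG.parents] using hi
          have := hG'.1 (σ.symm i) (σ.symm j) (by simpa using hij)
          simpa [predecessors] using this
  by_cases hpx : 1 - p * x ≤ 0
  · refine (mul_nonpos_of_nonpos_of_nonneg hpx
      (Finset.sum_nonneg fun _ _ => (Real.exp_pos _).le)).trans (Real.exp_pos _).le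
  push Not at hpx
  have h2 : 1 - p * x ≤ (1 - x) ^ p := by
    have := one_add_mul_le_pow (show (-2 : ℝ) ≤ -x by linarith) p
    calc 1 - p * x = 1 + p * -x := by ring
      _ ≤ (1 + -x) ^ p := this
      _ = _ := by ring_nf
  calc _ ≤ (1 - x) ^ p * ∏ j, ∑ S ∈ candidates σ j d, Real.exp (f j S) := by
        refine mul_le_mul h2 h1 (Finset.sum_nonneg fun _ _ => (Real.exp_pos _).le) ?_
        exact hpx.le.trans h2
    _ = ∏ j, ((1 - x) * ∑ S ∈ candidates σ j d, Real.exp (f j S)) := by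
        rw [Finset.prod_mul_distrib]; simp
    _ ≤ ∏ j, Real.exp (f j (Sstar j)) := by
        refine Finset.prod_le_prod (fun j _ => ?_) fun j _ => hnode j
        exact mul_nonneg (by linarith) (Finset.sum_nonneg fun _ _ => (Real.exp_pos _).le)
    _ = _ := (Real.exp_sum _ _).symm

/-- Makes the denominator in (iii) positive. The empty graph serves, so whether the minimal I-map
meets the out-degree bound never enters. -/
theorem sparseDAGs_nonempty (σ : Equiv.Perm (Fin p)) (d dout : ℕ) :
    (sparseDAGs σ d dout).Nonempty := by
  classical
  refine ⟨⟨∅, fun v h => ?_⟩, ?_⟩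
  · cases h with
    | single h => simp at h
    | tail _ h => simp at h
  · refine Finset.mem_filter.2 ⟨Finset.mem_univ _, ?_⟩
    simp [DAG.HasOrdering, DAG.parents, DAG.children]

end Concentration

/-! ### The modified Cholesky decomposition -/

section Cholesky

variable {p : ℕ} {Sig : Matrix (Fin p) (Fin p) ℝ}

/-- The coefficients of the best linear predictor of variable `j` from the variables in `A`. -/
def popCoef (Sig : Matrix (Fin p) (Fin p) ℝ) (j : Fin p) (A : Finset (Fin p)) : Fin p → ℝ :=
  fun k => if h : k ∈ A then
    ((Sig.submatrix (fun i : A => (i : Fin p)) (fun i : A => (i : Fin p)))⁻¹ *ᵥ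
      fun i : A => Sig i j) ⟨k, h⟩ else 0

/-- The coefficient vector of the population residual of variable `j` on the variables in `A`. -/
def popResidual (Sig : Matrix (Fin p) (Fin p) ℝ) (j : Fin p) (A : Finset (Fin p)) : Fin p → ℝ :=
  Pi.single j 1 - popCoef Sig j A

theorem popCoef_of_notMem (Sig : Matrix (Fin p) (Fin p) ℝ) (j : Fin p) {A : Finset (Fin p)}
    {k : Fin p} (hk : k ∉ A) : popCoef Sig j A k = 0 := by
  simp [popCoef, hk]

theorem mulVec_popResidual (hSig : Sig.PosDef) (j : Fin p) {A : Finset (Fin p)} {k : Fin p}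
    (hk : k ∈ A) : (Sig *ᵥ popResidual Sig j A) k = 0 := by
  have hu : IsUnit (Sig.submatrix (fun i : A => (i : Fin p)) (fun i : A => (i : Fin p))).det :=
    (hSig.submatrix Subtype.val_injective).det_pos.ne'.isUnit
  have h1 : (Sig *ᵥ popCoef Sig j A) k = Sig k j := by
    have h2 : (Sig.submatrix (fun i : A => (i : Fin p)) (fun i : A => (i : Fin p)) *ᵥ
        ((Sig.submatrix (fun i : A => (i : Fin p)) (fun i : A => (i : Fin p)))⁻¹ *ᵥ
          fun i : A => Sig i j)) ⟨k, hk⟩ = Sig k j := by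
      rw [Matrix.mulVec_mulVec, Matrix.mul_nonsing_inv _ hu, Matrix.one_mulVec]
    rw [← h2]
    simp only [Matrix.mulVec, dotProduct, Matrix.submatrix_apply]
    rw [← Finset.sum_subset (Finset.subset_univ A) fun l _ hl => by
      rw [popCoef_of_notMem Sig j hl, mul_zero], ← Finset.sum_coe_sort A]
    refine Finset.sum_congr rfl fun l _ => ?_
    simp [popCoef, Matrix.mulVec, dotProduct]
  rw [popResidual, Matrix.mulVec_sub, Pi.sub_apply, h1]
  simp

theorem dotProduct_mulVec_eq_zero {A : Finset (Fin p)} {w u : Fin p → ℝ}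
    (hw : ∀ k ∈ A, w k = 0) (hu : ∀ i ∉ A, u i = 0) : u ⬝ᵥ w = 0 := by
  refine Finset.sum_eq_zero fun i _ => ?_
  by_cases hi : i ∈ A
  · rw [hw i hi, mul_zero]
  · rw [hu i hi, zero_mul]

theorem dotProduct_mulVec_comm (hSig : Sig.PosDef) (u v : Fin p → ℝ) :
    u ⬝ᵥ Sig *ᵥ v = v ⬝ᵥ Sig *ᵥ u := by
  have : Sigᵀ = Sig := by
    have := hSig.isHermitian.eq
    rwa [Matrix.conjTranspose_eq_transpose_of_trivial] at this
  rw [Matrix.dotProduct_mulVec, ← Matrix.mulVec_transpose, this, dotProduct_comm]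

theorem dotProduct_mulVec_pos (hSig : Sig.PosDef) {u : Fin p → ℝ} (hu : u ≠ 0) :
    0 < u ⬝ᵥ Sig *ᵥ u := by
  have := hSig.dotProduct_mulVec_pos hu
  simpa using this

/-- The difference of two such vectors is supported on `A` and `Sig`-orthogonal to all vectors
supported there, so positive definiteness makes it zero. -/
theorem popResidual_unique (hSig : Sig.PosDef) {j : Fin p} {A : Finset (Fin p)} {β : Fin p → ℝ}
    (hβ : ∀ i ∉ A, β i = 0) (hor : ∀ k ∈ A, (Sig *ᵥ (Pi.single j 1 - β)) k = 0) :
    Pi.single j 1 - β = popResidual Sig j A := by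
  by_contra hne
  have h1 := dotProduct_mulVec_pos hSig (sub_ne_zero.2 hne)
  have e : Pi.single j 1 - β - popResidual Sig j A = popCoef Sig j A - β := by
    rw [popResidual]; abel
  have h2 : (Pi.single j 1 - β - popResidual Sig j A) ⬝ᵥ
      Sig *ᵥ (Pi.single j 1 - β - popResidual Sig j A) = 0 := by
    conv_lhs => enter [1]; rw [e]
    refine dotProduct_mulVec_eq_zero (A := A) (fun k hk => ?_) fun i hi => ?_
    · rw [Matrix.mulVec_sub, Pi.sub_apply, hor k hk, mulVec_popResidual hSig j hk, sub_zero]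
    · simp [hβ i hi, popCoef_of_notMem Sig j hi]
  linarith

theorem mem_predecessors {σ : Equiv.Perm (Fin p)} {j k : Fin p} :
    k ∈ predecessors σ j ↔ σ.symm k < σ.symm j := by
  simp [predecessors]

/-- Regress each variable on its predecessors. The residual vectors are pairwise `Sig`-orthogonal,
so `(1 - B)ᵀ * Sig * (1 - B)` is diagonal. -/
theorem exists_isModifiedCholesky (hSig : Sig.PosDef) (σ : Equiv.Perm (Fin p)) :
    ∃ B ω, IsModifiedCholesky Sig σ B ω := by
  set b : Fin p → Fin p → ℝ := fun j => popResidual Sig j (predecessors σ j) with hb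
  set B : Matrix (Fin p) (Fin p) ℝ := Matrix.of fun i j => popCoef Sig j (predecessors σ j) i
  have hcol : ∀ j, (1 - B).col j = b j := by
    intro j
    ext i
    simp [B, hb, popResidual, Matrix.one_apply, Pi.single_apply]
  have hself : ∀ j, b j j = 1 := by
    intro j
    have : j ∉ predecessors σ j := by simp [mem_predecessors]
    simp [hb, popResidual, popCoef_of_notMem Sig j this]
  have hbne : ∀ j, b j ≠ 0 := fun j h => by
    have := hself j; rw [h] at this; simp at this
  have hlt : ∀ i j, σ.symm i < σ.symm j → b i ⬝ᵥ Sig *ᵥ b j = 0 := by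
    intro i j hij
    refine dotProduct_mulVec_eq_zero (A := predecessors σ j)
      (fun k hk => mulVec_popResidual hSig j hk) fun k hk => ?_
    rw [mem_predecessors, not_lt] at hk
    have hki : k ≠ i := by rintro rfl; exact absurd hij (not_lt.2 hk)
    have : k ∉ predecessors σ i := by
      rw [mem_predecessors, not_lt]; exact hij.le.trans hk
    simp [hb, popResidual, popCoef_of_notMem Sig i this, hki]
  set ω : Fin p → ℝ := fun j => b j ⬝ᵥ Sig *ᵥ b j
  have hω : ∀ j, 0 < ω j := fun j => dotProduct_mulVec_pos hSig (hbne j)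
  have hD : (1 - B)ᵀ * Sig * (1 - B) = Matrix.diagonal ω := by
    ext i j
    have : ((1 - B)ᵀ * Sig * (1 - B) : Matrix (Fin p) (Fin p) ℝ) i j = b i ⬝ᵥ Sig *ᵥ b j := by
      rw [Matrix.mul_assoc, Matrix.mul_apply']
      rw [← hcol i, ← hcol j]
      congr 1
    rw [this, Matrix.diagonal_apply]
    split_ifs with hij
    · rw [hij]
    · rcases lt_trichotomy (σ.symm i) (σ.symm j) with h | h | h
      · exact hlt i j h
      · exact absurd (σ.symm.injective h) hij
      · rw [dotProduct_mulVec_comm hSig]; exact hlt j i h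
  have hdet : IsUnit (1 - B).det := by
    have h1 : ((1 - B)ᵀ * Sig * (1 - B)).det ≠ 0 := by
      rw [hD, Matrix.det_diagonal]
      exact Finset.prod_ne_zero_iff.2 fun j _ => (hω j).ne'
    rw [Matrix.det_mul] at h1
    exact (right_ne_zero_of_mul h1).isUnit
  have hdetT : IsUnit (1 - B)ᵀ.det := by rwa [Matrix.det_transpose]
  refine ⟨B, ω, fun i j hij => popCoef_of_notMem Sig j ?_, hω, ?_⟩
  · rw [mem_predecessors, not_lt]; exact hij
  · have hT : (1 : Matrix (Fin p) (Fin p) ℝ) - Bᵀ = (1 - B)ᵀ := by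
      rw [Matrix.transpose_sub, Matrix.transpose_one]
    rw [hT, ← hD, Matrix.mul_assoc, Matrix.mul_assoc ((1 - B)ᵀ * Sig),
      Matrix.mul_nonsing_inv _ hdet, Matrix.mul_one, ← Matrix.mul_assoc,
      Matrix.nonsing_inv_mul _ hdetT, Matrix.one_mul]

theorem cholFactor_isModifiedCholesky (hSig : Sig.PosDef) (σ : Equiv.Perm (Fin p)) :
    ∃ ω, IsModifiedCholesky Sig σ (cholFactor Sig σ) ω := by
  have h := exists_isModifiedCholesky hSig σ
  rw [cholFactor, dif_pos h]
  exact h.choose_spec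

/-- The residual coefficient vector `e_j - (B*_σ)_j`. -/
def cholResidual (Sig : Matrix (Fin p) (Fin p) ℝ) (σ : Equiv.Perm (Fin p)) (j : Fin p) :
    Fin p → ℝ :=
  Pi.single j 1 - (cholFactor Sig σ).col j

/-- `cholFactor` is merely some factor, so its regression meaning must be derived from the
factorization, which gives pairwise orthogonality of the residual vectors only. -/
theorem cholResidual_orthogonal (hSig : Sig.PosDef) (σ : Equiv.Perm (Fin p)) (j : Fin p)
    {k : Fin p} (hk : k ∈ predecessors σ j) : (Sig *ᵥ cholResidual Sig σ j) k = 0 := by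
  obtain ⟨ω, hB0, hω, hfac⟩ := cholFactor_isModifiedCholesky hSig σ
  set B := cholFactor Sig σ with hB
  have hT : (1 : Matrix (Fin p) (Fin p) ℝ) - Bᵀ = (1 - B)ᵀ := by
    rw [Matrix.transpose_sub, Matrix.transpose_one]
  have hdet : IsUnit (1 - B).det := by
    have h1 : Sig.det ≠ 0 := hSig.det_pos.ne'
    rw [← hfac, Matrix.det_mul] at h1
    have h2 := right_ne_zero_of_mul h1
    rw [Matrix.det_nonsing_inv, Ring.inverse_eq_inv'] at h2
    exact (IsUnit.mk0 _ fun h0 => h2 (by rw [h0, inv_zero]))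
  have hdetT : IsUnit (1 - B)ᵀ.det := by rwa [Matrix.det_transpose]
  have hD : (1 - B)ᵀ * Sig * (1 - B) = Matrix.diagonal ω := by
    rw [← hfac, hT, Matrix.mul_assoc, Matrix.mul_assoc, Matrix.nonsing_inv_mul _ hdet,
      Matrix.mul_one, ← Matrix.mul_assoc, Matrix.mul_nonsing_inv _ hdetT, Matrix.one_mul]
  set b : Fin p → Fin p → ℝ := fun j => cholResidual Sig σ j with hb
  have hcol : ∀ j, (1 - B).col j = b j := by
    intro j
    ext i
    simp [hb, cholResidual, Matrix.one_apply, Pi.single_apply, hB]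
  have hbb : ∀ i j, i ≠ j → b i ⬝ᵥ Sig *ᵥ b j = 0 := by
    intro i j hij
    have h1 : ((1 - B)ᵀ * Sig * (1 - B) : Matrix (Fin p) (Fin p) ℝ) i j = b i ⬝ᵥ Sig *ᵥ b j := by
      rw [Matrix.mul_assoc, Matrix.mul_apply']
      rw [← hcol i, ← hcol j]
      congr 1
    rw [← h1, hD, Matrix.diagonal_apply_ne _ hij]
  -- Induction on the position of `k`: the unit vector at `k` is the residual vector of `k` plus a
  -- combination of unit vectors at earlier positions.
  have key : ∀ m : ℕ, ∀ k : Fin p, (σ.symm k : ℕ) = m → k ∈ predecessors σ j →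
      (Sig *ᵥ b j) k = 0 := by
    intro m
    induction m using Nat.strong_induction_on with
    | _ m ih =>
      intro k hkm hk
      rw [mem_predecessors] at hk
      have hkj : k ≠ j := by rintro rfl; exact lt_irrefl _ hk
      have h1 := hbb k j hkj
      have h2 : b k ⬝ᵥ Sig *ᵥ b j = (Sig *ᵥ b j) k - B.col k ⬝ᵥ Sig *ᵥ b j := by
        simp [hb, cholResidual, sub_dotProduct, hB]
      have h3 : B.col k ⬝ᵥ Sig *ᵥ b j = 0 := by
        refine dotProduct_mulVec_eq_zero (A := predecessors σ k) (fun l hl => ?_) fun l hl => ?_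
        · rw [mem_predecessors] at hl
          exact ih (σ.symm l) (hkm ▸ hl) l rfl (mem_predecessors.2 (hl.trans hk))
        · rw [mem_predecessors, not_lt] at hl
          exact hB0 l k hl
      linarith
  exact key _ k rfl hk

theorem mem_trueParents {σ : Equiv.Perm (Fin p)} {i j : Fin p} :
    i ∈ trueParents Sig σ j ↔ cholFactor Sig σ i j ≠ 0 := by
  simp [trueParents, DAG.parents, minimalIMap]

theorem trueParents_subset (σ : Equiv.Perm (Fin p)) (j : Fin p) :
    trueParents Sig σ j ⊆ predecessors σ j := by
  intro i hi
  rw [mem_trueParents] at hi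
  rw [mem_predecessors]
  by_contra h
  exact hi (cholFactor_eq_zero Sig σ i j (not_lt.1 h))

theorem cholFactor_of_notMem {σ : Equiv.Perm (Fin p)} {i j : Fin p}
    (h : i ∉ trueParents Sig σ j) : cholFactor Sig σ i j = 0 := by
  by_contra hne
  exact h (mem_trueParents.2 hne)

theorem card_trueParents_le_dStar (σ : Equiv.Perm (Fin p)) (j : Fin p) :
    (trueParents Sig σ j).card ≤ dStar Sig :=
  calc (trueParents Sig σ j).card
      ≤ ((minimalIMap Sig σ).parents j ∪ (minimalIMap Sig σ).children j).card :=
        Finset.card_le_card Finset.subset_union_left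
    _ ≤ (minimalIMap Sig σ).maxDegree := Finset.le_sup
        (f := fun j => ((minimalIMap Sig σ).parents j ∪ (minimalIMap Sig σ).children j).card)
        (Finset.mem_univ j)
    _ ≤ dStar Sig := Finset.le_sup (f := fun σ => (minimalIMap Sig σ).maxDegree)
        (Finset.mem_univ σ)

/-- The residual depends on the ordering only through the parent set. -/
theorem cholResidual_eq_popResidual (hSig : Sig.PosDef) (σ : Equiv.Perm (Fin p)) (j : Fin p) :
    cholResidual Sig σ j = popResidual Sig j (trueParents Sig σ j) :=
  popResidual_unique hSig (fun _ hi => cholFactor_of_notMem hi) fun _ hk =>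
    cholResidual_orthogonal hSig σ j (trueParents_subset σ j hk)

/-! ### The quadratic form of the covariance matrix -/

/-- The residual variance. -/
def residualVar (Sig : Matrix (Fin p) (Fin p) ℝ) (b : Fin p → ℝ) : ℝ := b ⬝ᵥ Sig *ᵥ b

/-- Pythagoras for the inner product of `Sig`. -/
theorem residualVar_add (hSig : Sig.PosDef) {A : Finset (Fin p)} {b u : Fin p → ℝ}
    (hb : ∀ k ∈ A, (Sig *ᵥ b) k = 0) (hu : ∀ i ∉ A, u i = 0) :
    residualVar Sig (b + u) = residualVar Sig b + residualVar Sig u := by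
  have h1 := dotProduct_mulVec_eq_zero hb hu
  have h2 : b ⬝ᵥ Sig *ᵥ u = 0 := by rw [dotProduct_mulVec_comm hSig, h1]
  simp only [residualVar, Matrix.mulVec_add, dotProduct_add, add_dotProduct, h1, h2]
  ring

theorem residualVar_nonneg (hSig : Sig.PosDef) (u : Fin p → ℝ) : 0 ≤ residualVar Sig u := by
  by_cases h : u = 0
  · simp [h, residualVar]
  · exact (dotProduct_mulVec_pos hSig h).le

/-- `Sig - a` and `b - Sig` are positive semidefinite, their eigenvalues coming from the spectrum of
`Sig` by a shift and, in the second case, a reflection. -/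
theorem residualVar_bounds (hSig : Sig.PosDef) {a b : ℝ}
    (h : ∀ lam ∈ spectrum ℝ Sig, a ≤ lam ∧ lam ≤ b) (u : Fin p → ℝ) :
    a * (u ⬝ᵥ u) ≤ residualVar Sig u ∧ residualVar Sig u ≤ b * (u ⬝ᵥ u) := by
  have hh := hSig.isHermitian
  have hone : ∀ c : ℝ, (algebraMap ℝ (Matrix (Fin p) (Fin p) ℝ) c) *ᵥ u = c • u := fun c => by
    rw [Algebra.algebraMap_eq_smul_one, Matrix.smul_mulVec, Matrix.one_mulVec]
  have hher : ∀ c : ℝ, (algebraMap ℝ (Matrix (Fin p) (Fin p) ℝ) c).IsHermitian := fun c => by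
    rw [Algebra.algebraMap_eq_smul_one]
    exact Matrix.isHermitian_one.smul (IsSelfAdjoint.all c)
  constructor
  · have h1 : (Sig - algebraMap ℝ _ a).PosSemidef := by
      rw [(hh.sub (hher a)).posSemidef_iff_eigenvalues_nonneg]
      intro i
      have h2 := (hh.sub (hher a)).eigenvalues_mem_spectrum_real i
      have h3 : (hh.sub (hher a)).eigenvalues i + a ∈ spectrum ℝ Sig := by
        rw [spectrum.mem_iff] at h2 ⊢
        convert h2 using 2
        rw [map_add]; abel
      have := (h _ h3).1
      simp only [Pi.zero_apply]
      linarith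
    have h2 := h1.dotProduct_mulVec_nonneg u
    simp only [star_trivial, Matrix.sub_mulVec, hone, dotProduct_sub, dotProduct_smul,
      smul_eq_mul] at h2
    rw [residualVar]
    linarith
  · have h1 : (algebraMap ℝ _ b - Sig).PosSemidef := by
      rw [((hher b).sub hh).posSemidef_iff_eigenvalues_nonneg]
      intro i
      have h2 := ((hher b).sub hh).eigenvalues_mem_spectrum_real i
      have h3 : b - ((hher b).sub hh).eigenvalues i ∈ spectrum ℝ Sig := by
        rw [spectrum.mem_iff] at h2 ⊢
        rw [← IsUnit.neg_iff]
        convert h2 using 2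
        rw [map_sub]; abel
      have := (h _ h3).2
      simp only [Pi.zero_apply]
      linarith
    have h2 := h1.dotProduct_mulVec_nonneg u
    simp only [star_trivial, Matrix.sub_mulVec, hone, dotProduct_sub, dotProduct_smul,
      smul_eq_mul] at h2
    rw [residualVar]
    linarith

end Cholesky

/-! ### Nets for quadratic forms -/

section Net

/-- A finite `1`-net of the ball of radius `2`. -/
theorem exists_finset_net (E : Type*) [NormedAddCommGroup E] [NormedSpace ℝ E]
    [FiniteDimensional ℝ E] :
    ∃ N : Finset E, N.card ≤ 5 ^ Module.finrank ℝ E ∧ (∀ x ∈ N, ‖x‖ ≤ 2) ∧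
      ∀ u : E, ‖u‖ ≤ 2 → ∃ x ∈ N, ‖u - x‖ ≤ 1 := by
  classical
  let good : Finset E → Prop := fun s =>
    (∀ c ∈ s, ‖c‖ ≤ 2) ∧ ∀ c ∈ s, ∀ d ∈ s, c ≠ d → 1 ≤ ‖c - d‖
  have hbdd : ∀ s, good s → s.card ≤ 5 ^ Module.finrank ℝ E := fun s hs =>
    Besicovitch.card_le_of_separated s hs.1 hs.2
  -- A 1-separated set of maximal cardinality is a net, since an uncovered point could be added; the
  -- volume bound `hbdd` makes the maximum exist.
  obtain ⟨N, hN, hmax⟩ : ∃ N, good N ∧ ∀ s, good s → s.card ≤ N.card := by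
    have hP : ∃ s, good s ∧ s.card = Nat.findGreatest (fun m => ∃ s, good s ∧ s.card = m)
        (5 ^ Module.finrank ℝ E) :=
      Nat.findGreatest_spec (P := fun m => ∃ s, good s ∧ s.card = m) (Nat.zero_le _)
        ⟨∅, ⟨by simp, by simp⟩, rfl⟩
    obtain ⟨N, hN, hcard⟩ := hP
    refine ⟨N, hN, fun s hs => ?_⟩
    rw [hcard]
    exact Nat.le_findGreatest (hbdd s hs) ⟨s, hs, rfl⟩
  refine ⟨N, hbdd N hN, hN.1, fun u hu => ?_⟩
  by_contra! hc
  have huN : u ∉ N := fun h => by have := hc u h; simp at this; linarith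
  have h1 : good (insert u N) := by
    refine ⟨fun c hcm => ?_, fun c hcm e he hne => ?_⟩
    · rcases Finset.mem_insert.1 hcm with rfl | h
      · exact hu
      · exact hN.1 c h
    · rcases Finset.mem_insert.1 hcm with rfl | h <;> rcases Finset.mem_insert.1 he with rfl | h'
      · exact absurd rfl hne
      · exact (hc e h').le
      · rw [norm_sub_rev]; exact (hc c h).le
      · exact hN.2 c h e h' hne
  have h2 := hmax _ h1
  rw [Finset.card_insert_of_notMem huN] at h2
  omega

/-- On the sphere of radius 2 the net gives |f| ≤ c + ‖f‖; rescaling, ‖f‖ ≤ (c + ‖f‖)/2, hence ‖f‖ ≤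
c. Radius 2 with mesh 1 makes this self-bound close. -/
theorem abs_le_of_net {E : Type*} [NormedAddCommGroup E] [NormedSpace ℝ E]
    [FiniteDimensional ℝ E] {N : Finset E} (hN : ∀ u : E, ‖u‖ ≤ 2 → ∃ x ∈ N, ‖u - x‖ ≤ 1)
    (f : E →ₗ[ℝ] ℝ) {c : ℝ} (hc : 0 ≤ c) (hf : ∀ x ∈ N, |f x| ≤ c) (u : E) : |f u| ≤ c * ‖u‖ := by
  set F : E →L[ℝ] ℝ := LinearMap.toContinuousLinearMap f with hF
  have hFf : ∀ x, F x = f x := fun x => rfl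
  have h2 : ∀ u : E, ‖u‖ ≤ 2 → |f u| ≤ c + ‖F‖ := by
    intro u hu
    obtain ⟨x, hx, hux⟩ := hN u hu
    have h3 : f u = f x + F (u - x) := by rw [hFf, map_sub]; ring
    calc |f u| ≤ |f x| + |F (u - x)| := by rw [h3]; exact abs_add_le _ _
      _ ≤ c + ‖F‖ * ‖u - x‖ := add_le_add (hf x hx) (F.le_opNorm _)
      _ ≤ c + ‖F‖ * 1 := by gcongr
      _ = _ := by ring
  have h3 : ‖F‖ ≤ (c + ‖F‖) / 2 := by
    refine F.opNorm_le_bound (by positivity) fun x => ?_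
    rcases eq_or_ne x 0 with rfl | hx
    · simp
    have hx0 : 0 < ‖x‖ := norm_pos_iff.2 hx
    have h4 := h2 ((2 / ‖x‖) • x) (by rw [norm_smul, Real.norm_eq_abs, abs_of_pos (by positivity)]
                                      field_simp; rfl)
    rw [map_smul, smul_eq_mul, abs_mul, abs_of_pos (show 0 < 2 / ‖x‖ by positivity)] at h4
    rw [Real.norm_eq_abs, hFf]
    rw [div_mul_eq_mul_div, div_le_iff₀ hx0] at h4
    linarith
  have h4 : ‖F‖ ≤ c := by linarith
  calc |f u| = ‖F u‖ := rfl
    _ ≤ ‖F‖ * ‖u‖ := F.le_opNorm u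
    _ ≤ _ := by gcongr

/-- There are at most `2 * 25 ^ dim` test vectors that control a quadratic form relative to a
positive definite one. -/
theorem exists_test_vectors {E : Type*} [AddCommGroup E] [Module ℝ E] [FiniteDimensional ℝ E]
    (Q : E →ₗ[ℝ] E →ₗ[ℝ] ℝ) (hsymm : ∀ u v, Q u v = Q v u) (hpos : ∀ u, u ≠ 0 → 0 < Q u u) :
    ∃ N : Finset E, N.card ≤ 2 * 25 ^ Module.finrank ℝ E ∧
      ∀ M : E →ₗ[ℝ] E →ₗ[ℝ] ℝ, (∀ u v, M u v = M v u) → ∀ c : ℝ, 0 ≤ c →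
        (∀ x ∈ N, |M x x| ≤ c * Q x x) → ∀ u, |M u u| ≤ 4 * c * Q u u := by
  classical
  let core : InnerProductSpace.Core ℝ E :=
    { inner := fun u v => Q u v
      conj_inner_symm := fun u v => by simp [hsymm u v]
      re_inner_nonneg := fun u => by
        rcases eq_or_ne u 0 with rfl | h
        · simp
        · simpa using (hpos u h).le
      add_left := fun u v w => by simp
      smul_left := fun u v r => by simp
      definite := fun u h => by
        by_contra hne
        exact (hpos u hne).ne' h }
  let _ : NormedAddCommGroup E := core.toNormedAddCommGroup
  let _ : InnerProductSpace ℝ E := InnerProductSpace.ofCore core.toCore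
  have hQ : ∀ u, Q u u = ‖u‖ ^ 2 := fun u => (real_inner_self_eq_norm_sq u)
  obtain ⟨N, hcard, hN2, hnet⟩ := exists_finset_net E
  -- Sums and differences of net points: by polarization, bounds on the diagonal of `M` at these
  -- points control `M x y` for net points `x`, `y`.
  refine ⟨(N ×ˢ N).image (fun z => z.1 + z.2) ∪ (N ×ˢ N).image (fun z => z.1 - z.2), ?_, ?_⟩
  · have h25 : (N ×ˢ N).card ≤ 25 ^ Module.finrank ℝ E := by
      rw [Finset.card_product]
      calc N.card * N.card ≤ 5 ^ Module.finrank ℝ E * 5 ^ Module.finrank ℝ E :=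
            Nat.mul_le_mul hcard hcard
        _ = _ := by rw [← mul_pow]; norm_num
    refine (Finset.card_union_le _ _).trans ?_
    have h1 := (Finset.card_image_le (s := N ×ˢ N) (f := fun z => z.1 + z.2)).trans h25
    have h2 := (Finset.card_image_le (s := N ×ˢ N) (f := fun z => z.1 - z.2)).trans h25
    omega
  intro M hM c hc hle
  have hNN : ∀ x ∈ N, ∀ y ∈ N, |M x y| ≤ 4 * c := by
    intro x hx y hy
    have hmem : (x, y) ∈ N ×ˢ N := Finset.mk_mem_product hx hy
    have h1 := hle (x + y) (Finset.mem_union_left _ (Finset.mem_image_of_mem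
      (fun z : E × E => z.1 + z.2) hmem))
    have h2 := hle (x - y) (Finset.mem_union_right _ (Finset.mem_image_of_mem
      (fun z : E × E => z.1 - z.2) hmem))
    have e1 : M (x + y) (x + y) - M (x - y) (x - y) = 4 * M x y := by
      simp only [map_add, map_sub, LinearMap.add_apply, LinearMap.sub_apply, hM y x]; ring
    have e2 : Q (x + y) (x + y) + Q (x - y) (x - y) = 2 * (Q x x + Q y y) := by
      simp only [map_add, map_sub, LinearMap.add_apply, LinearMap.sub_apply]; ring
    have h3 : Q x x ≤ 4 := by rw [hQ]; nlinarith [hN2 x hx, norm_nonneg x]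
    have h4 : Q y y ≤ 4 := by rw [hQ]; nlinarith [hN2 y hy, norm_nonneg y]
    have h5 : |4 * M x y| ≤ 16 * c := by
      rw [← e1]
      refine (abs_sub _ _).trans ((add_le_add h1 h2).trans ?_)
      rw [← mul_add, e2]
      nlinarith
    rw [abs_mul, abs_of_pos (by norm_num : (0 : ℝ) < 4)] at h5
    linarith
  intro u
  -- Bilinearity lets the net argument run in one variable at a time, so nothing is lost beyond the
  -- factor 4 from polarization.
  have hu : ∀ y ∈ N, |M u y| ≤ 4 * c * ‖u‖ := by
    intro y hy
    rw [hM u y]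
    exact abs_le_of_net hnet (M y) (by positivity) (fun x hx => hNN y hy x hx) u
  have := abs_le_of_net hnet (M u) (by positivity) hu u
  rw [hQ]
  calc |M u u| ≤ 4 * c * ‖u‖ * ‖u‖ := this
    _ = _ := by ring

end Net

/-! ### Chi-square tail bounds -/

section ChiSquare

variable {Ω : Type*} [MeasurableSpace Ω] {P : Measure Ω}

theorem integral_exp_mul_sq_gaussianReal {v : NNReal} (hv : v ≠ 0) {θ : ℝ} (hθ : 2 * θ < 1) :
    Integrable (fun x => Real.exp (θ / v * x ^ 2)) (gaussianReal 0 v) ∧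
      ∫ x, Real.exp (θ / v * x ^ 2) ∂(gaussianReal 0 v) = (√(1 - 2 * θ))⁻¹ := by
  have hv0 : (0 : ℝ) < v := by positivity
  have hb : 0 < (1 - 2 * θ) / (2 * v) := div_pos (by linarith) (by positivity)
  have e : ∀ x : ℝ, gaussianPDFReal 0 v x * Real.exp (θ / v * x ^ 2) =
      (√(2 * Real.pi * v))⁻¹ * Real.exp (-((1 - 2 * θ) / (2 * v)) * x ^ 2) := by
    intro x
    rw [gaussianPDFReal, mul_assoc, ← Real.exp_add]
    congr 2
    field_simp
    ring
  constructor
  · rw [gaussianReal_of_var_ne_zero 0 hv]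
    refine (integrable_withDensity_iff_integrable_smul' (measurable_gaussianPDF 0 v)
      (ae_of_all _ fun _ => gaussianPDF_lt_top)).2 ?_
    simp only [toReal_gaussianPDF, smul_eq_mul, e]
    exact (integrable_exp_neg_mul_sq hb).const_mul _
  · rw [integral_gaussianReal_eq_integral_smul hv]
    simp only [smul_eq_mul, e]
    rw [integral_const_mul, integral_gaussian, ← Real.sqrt_inv, ← Real.sqrt_mul (by positivity),
      ← Real.sqrt_inv]
    congr 1
    have : 1 - 2 * θ ≠ 0 := by linarith
    field_simp

/-- The left side is exp(-log(1 - 2θ)/2), and the first-order Taylor remainder of the logarithm is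
at most 8θ² on this range. -/
theorem inv_sqrt_le_exp {θ : ℝ} (hθ : |θ| ≤ 1 / 4) :
    (√(1 - 2 * θ))⁻¹ ≤ Real.exp (θ + 4 * θ ^ 2) := by
  have hx : |2 * θ| ≤ 1 / 2 := by rw [abs_mul, abs_two]; linarith
  have h1 := Real.abs_log_sub_add_sum_range_le (show |2 * θ| < 1 by linarith) 1
  simp only [Finset.sum_range_one, Nat.cast_zero, zero_add, pow_one, div_one] at h1
  have h2 : |2 * θ| ^ (1 + 1) / (1 - |2 * θ|) ≤ 8 * θ ^ 2 := by
    rw [div_le_iff₀ (by linarith), one_add_one_eq_two, sq_abs]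
    nlinarith [sq_nonneg θ]
  have h3 := (abs_le.1 (h1.trans h2)).1
  have h4 : 0 < 1 - 2 * θ := by have := (abs_le.1 hθ).2; linarith
  rw [← Real.exp_log (show 0 < (√(1 - 2 * θ))⁻¹ by positivity), Real.log_inv,
    Real.log_sqrt h4.le]
  refine Real.exp_le_exp.2 ?_
  linarith

variable {n : ℕ} {Z : Fin n → Ω → ℝ} {v : NNReal}

theorem mgf_sum_sq_le (hZ : ∀ i, HasLaw (Z i) (gaussianReal 0 v) P) (hind : iIndepFun Z P)
    (hv : v ≠ 0) {θ : ℝ} (hθ : |θ| ≤ 1 / 4) :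
    Integrable (fun ω => Real.exp (θ / v * ∑ i, Z i ω ^ 2)) P ∧
      mgf (fun ω => ∑ i, Z i ω ^ 2) P (θ / v) ≤ Real.exp (n * (θ + 4 * θ ^ 2)) := by
  have hP : IsProbabilityMeasure P := hind.isProbabilityMeasure
  have h2θ : 2 * θ < 1 := by have := (abs_le.1 hθ).2; linarith
  have hG := integral_exp_mul_sq_gaussianReal hv h2θ
  have hind2 : iIndepFun (fun i ω => Z i ω ^ 2) P :=
    hind.comp (fun _ x => x ^ 2) fun _ => by fun_prop
  have hmeas : ∀ i, AEMeasurable (fun ω => Z i ω ^ 2) P := fun i => (hZ i).aemeasurable.pow_const 2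
  have hfun : (fun ω => ∑ i, Z i ω ^ 2) = ∑ i, fun ω => Z i ω ^ 2 := by
    ext ω; simp
  have hmgf : mgf (fun ω => ∑ i, Z i ω ^ 2) P (θ / v) = (√(1 - 2 * θ))⁻¹ ^ n := by
    rw [hfun, hind2.mgf_sum₀ hmeas]
    have h1 : ∀ i, mgf (fun ω => Z i ω ^ 2) P (θ / v) = (√(1 - 2 * θ))⁻¹ := fun i => by
      rw [mgf, ← hG.2, ← (hZ i).map_eq, integral_map (hZ i).aemeasurable]
      exact ((by fun_prop : Continuous fun x : ℝ => Real.exp (θ / v * x ^ 2))).aestronglyMeasurable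
    simp only [h1, Finset.prod_const, Finset.card_univ, Fintype.card_fin]
  have hpos : 0 < √(1 - 2 * θ) := Real.sqrt_pos.2 (by linarith)
  constructor
  -- A non-integrable exponential would make `mgf` equal to 0 by convention, but the value just
  -- computed is positive.
  · by_contra hni
    have := mgf_undef hni
    rw [hmgf] at this
    exact (pow_pos (inv_pos.2 hpos) n).ne' this
  · rw [hmgf, Real.exp_nat_mul]
    exact pow_le_pow_left₀ (by positivity) (inv_sqrt_le_exp hθ) n

/-- Two-sided concentration of a sum of squares of independent centred Gaussians. -/
theorem measure_abs_sum_sq_sub_gt_le (hZ : ∀ i, HasLaw (Z i) (gaussianReal 0 v) P)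
    (hind : iIndepFun Z P) (hv : v ≠ 0) {η : ℝ} (hη : 0 ≤ η) (hη1 : η ≤ 1) :
    P {ω | η * (n * v) < |∑ i, Z i ω ^ 2 - n * v|} ≤
      ENNReal.ofReal (2 * Real.exp (-(n * η ^ 2 / 16))) := by
  have hP : IsProbabilityMeasure P := hind.isProbabilityMeasure
  have hv0 : (0 : ℝ) < v := by positivity
  have hup : P.real {ω | (1 + η) * (n * v) ≤ ∑ i, Z i ω ^ 2} ≤ Real.exp (-(n * η ^ 2 / 16)) := by
    -- Chernoff: the choice θ = η/8 minimizes the exponent n(4θ² - ηθ), with value -nη²/16.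
    have hθ : |η / 8| ≤ 1 / 4 := by rw [abs_of_nonneg (by positivity)]; linarith
    obtain ⟨hi, hm⟩ := mgf_sum_sq_le hZ hind hv hθ
    refine (measure_ge_le_exp_mul_mgf _ (t := η / 8 / v) (by positivity) hi).trans ?_
    refine (mul_le_mul_of_nonneg_left hm (Real.exp_pos _).le).trans_eq ?_
    rw [← Real.exp_add]
    congr 1
    field_simp
    ring
  have hlow : P.real {ω | ∑ i, Z i ω ^ 2 ≤ (1 - η) * (n * v)} ≤
      Real.exp (-(n * η ^ 2 / 16)) := by
    have hθ : |-(η / 8)| ≤ 1 / 4 := by rw [abs_neg, abs_of_nonneg (by positivity)]; linarith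
    obtain ⟨hi, hm⟩ := mgf_sum_sq_le hZ hind hv hθ
    refine (measure_le_le_exp_mul_mgf _ (t := -(η / 8) / v)
      (div_nonpos_of_nonpos_of_nonneg (by linarith) hv0.le) hi).trans ?_
    refine (mul_le_mul_of_nonneg_left hm (Real.exp_pos _).le).trans_eq ?_
    rw [← Real.exp_add]
    congr 1
    field_simp
    ring
  have hsub : {ω | η * (n * v) < |∑ i, Z i ω ^ 2 - n * v|} ⊆
      {ω | (1 + η) * (n * v) ≤ ∑ i, Z i ω ^ 2} ∪ {ω | ∑ i, Z i ω ^ 2 ≤ (1 - η) * (n * v)} := by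
    intro ω hω
    have hω' : η * (n * v) < |∑ i, Z i ω ^ 2 - n * v| := hω
    rcases lt_abs.1 hω' with h | h
    · left; show (1 + η) * (n * v) ≤ _; linarith
    · right; show _ ≤ (1 - η) * (n * v); linarith
  rw [← ENNReal.toReal_le_toReal (measure_ne_top _ _) ENNReal.ofReal_ne_top,
    ENNReal.toReal_ofReal (by positivity)]
  refine (measureReal_mono hsub).trans ((measureReal_union_le _ _).trans ?_)
  linarith

/-- Gaussian tail bound for a linear combination of independent centred Gaussians. -/
theorem measure_sq_dotProduct_gt_le (hZ : ∀ i, HasLaw (Z i) (gaussianReal 0 v) P)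
    (hind : iIndepFun Z P) (hv : v ≠ 0) (f : Fin n → ℝ) {s : ℝ} (hs : 0 ≤ s) :
    P {ω | v * s * (f ⬝ᵥ f) < ((fun i => Z i ω) ⬝ᵥ f) ^ 2} ≤
      ENNReal.ofReal (2 * Real.exp (-(s / 2))) := by
  have hP : IsProbabilityMeasure P := hind.isProbabilityMeasure
  have hv0 : (0 : ℝ) < v := by positivity
  rcases eq_or_ne f 0 with rfl | hf
  · simp
  have hff : 0 < f ⬝ᵥ f := lt_of_le_of_ne (dotProduct_self_nonneg' f)
    fun h => hf (dotProduct_self_eq_zero.1 h.symm)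
  have hsub : ∀ i, HasSubgaussianMGF (Z i) v P := fun i => by
    refine HasSubgaussianMGF.of_map (hZ i).aemeasurable (X := id) ?_
    rw [(hZ i).map_eq]
    refine ⟨fun t => ?_, fun t => ?_⟩
    · exact integrable_exp_mul_gaussianReal t
    · rw [mgf_id_gaussianReal]; simp
  have key : ∀ g : Fin n → ℝ, g ⬝ᵥ g = f ⬝ᵥ f →
      P.real {ω | √(v * s * (f ⬝ᵥ f)) ≤ ∑ i, g i * Z i ω} ≤ Real.exp (-(s / 2)) := by
    intro g hg
    have h1 : iIndepFun (fun i ω => g i * Z i ω) P :=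
      hind.comp (fun i x => g i * x) fun i => by fun_prop
    have h2 := HasSubgaussianMGF.measure_sum_ge_le_of_iIndepFun h1 (s := Finset.univ)
      (fun i _ => (hsub i).const_mul (g i)) (Real.sqrt_nonneg (v * s * (f ⬝ᵥ f)))
    refine h2.trans_eq ?_
    rw [Real.sq_sqrt (by positivity)]
    congr 1
    have h3 : ((∑ i, (⟨g i ^ 2, sq_nonneg _⟩ * v : NNReal) : NNReal) : ℝ) = (f ⬝ᵥ f) * v := by
      rw [← hg]
      push_cast
      simp only [dotProduct, Finset.sum_mul, ← pow_two]
      rfl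
    rw [h3]
    field_simp
  have hsub : {ω | v * s * (f ⬝ᵥ f) < ((fun i => Z i ω) ⬝ᵥ f) ^ 2} ⊆
      {ω | √(v * s * (f ⬝ᵥ f)) ≤ ∑ i, f i * Z i ω} ∪
        {ω | √(v * s * (f ⬝ᵥ f)) ≤ ∑ i, (-f) i * Z i ω} := by
    intro ω hω
    have h1 : √(v * s * (f ⬝ᵥ f)) ≤ |(fun i => Z i ω) ⬝ᵥ f| := by
      rw [← Real.sqrt_sq_eq_abs]
      exact Real.sqrt_le_sqrt (le_of_lt hω)
    have e1 : ∑ i, f i * Z i ω = (fun i => Z i ω) ⬝ᵥ f := by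
      simp only [dotProduct, mul_comm]
    rcases le_abs.1 h1 with h | h
    · left; show _ ≤ ∑ i, f i * Z i ω; rwa [e1]
    · right; show _ ≤ ∑ i, (-f) i * Z i ω
      simpa [e1] using h
  rw [← ENNReal.toReal_le_toReal (measure_ne_top _ _) ENNReal.ofReal_ne_top,
    ENNReal.toReal_ofReal (by positivity)]
  refine (measureReal_mono hsub).trans ((measureReal_union_le _ _).trans ?_)
  have := key f rfl
  have := key (-f) (by simp)
  linarith

end ChiSquare

/-! ### Gaussian design -/

section Counting

/-- Bound each binomial coefficient by a power times `d.choose i` and sum by the binomial theorem.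
For the p - 1 nodes other than `j` this gives p^d without extra constants. -/
theorem card_filter_card_le {α : Type*} (U : Finset α) (d : ℕ) :
    (U.powerset.filter fun S => S.card ≤ d).card ≤ (U.card + 1) ^ d := by
  classical
  have h1 : (U.powerset.filter fun S => S.card ≤ d) ⊆
      (Finset.range (d + 1)).biUnion fun i => Finset.powersetCard i U := by
    intro S hS
    have := Finset.mem_filter.1 hS
    exact Finset.mem_biUnion.2 ⟨S.card, Finset.mem_range.2 (by omega),
      Finset.mem_powersetCard.2 ⟨Finset.mem_powerset.1 this.1, rfl⟩⟩
  calc _ ≤ _ := Finset.card_le_card h1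
    _ ≤ ∑ i ∈ Finset.range (d + 1), (Finset.powersetCard i U).card := Finset.card_biUnion_le
    _ ≤ ∑ i ∈ Finset.range (d + 1), U.card ^ i * 1 ^ (d - i) * d.choose i := by
        refine Finset.sum_le_sum fun i hi => ?_
        rw [Finset.card_powersetCard, one_pow, mul_one]
        have : 0 < d.choose i := Nat.choose_pos (by have := Finset.mem_range.1 hi; omega)
        exact (Nat.choose_le_pow _ _).trans (Nat.le_mul_of_pos_right _ this)
    _ = _ := by rw [add_pow]; simp

end Counting

section Design

variable {Ω : Type*} {n p : ℕ} {Sig : Matrix (Fin p) (Fin p) ℝ}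
  {X : Fin n → Ω → EuclideanSpace ℝ (Fin p)}

/-- The data matrix whose rows are the observations. -/
def dataMatrix (X : Fin n → Ω → EuclideanSpace ℝ (Fin p)) (ω : Ω) : Matrix (Fin n) (Fin p) ℝ :=
  Matrix.of fun i k => X i ω k

theorem dataMatrix_mulVec (X : Fin n → Ω → EuclideanSpace ℝ (Fin p)) (ω : Ω) (u : Fin p → ℝ)
    (i : Fin n) : (dataMatrix X ω *ᵥ u) i = inner ℝ (WithLp.toLp 2 u) (X i ω) := by
  simp [dataMatrix, Matrix.mulVec, dotProduct, PiLp.inner_apply]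

variable [MeasurableSpace Ω] {P : Measure Ω}

theorem hasLaw_dataMatrix_mulVec (hSig : Sig.PosDef)
    (hX : ∀ i, HasLaw (X i) (multivariateGaussian 0 Sig) P) (u : Fin p → ℝ) (i : Fin n) :
    HasLaw (fun ω => (dataMatrix X ω *ᵥ u) i)
      (gaussianReal 0 (residualVar Sig u).toNNReal) P := by
  have hfun : (fun ω => (dataMatrix X ω *ᵥ u) i) =
      (innerSL ℝ (WithLp.toLp 2 u : EuclideanSpace ℝ (Fin p))) ∘ X i := by
    ext ω; rw [dataMatrix_mulVec]; rfl
  have hm := (hX i).aemeasurable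
  rw [hfun]
  refine ⟨(ContinuousLinearMap.measurable _).comp_aemeasurable hm, ?_⟩
  rw [← AEMeasurable.map_map_of_aemeasurable (by fun_prop) hm, (hX i).map_eq,
    IsGaussian.map_eq_gaussianReal]
  congr 1
  · rw [ContinuousLinearMap.integral_comp_id_comm]
    · simp
    · exact IsGaussian.integrable_id
  · congr 1
    have := covarianceBilin_self (μ := multivariateGaussian 0 Sig) IsGaussian.memLp_two_id
      (WithLp.toLp 2 u : EuclideanSpace ℝ (Fin p))
    rw [covarianceBilin_multivariateGaussian hSig.posSemidef] at this
    exact this.symm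

theorem iIndepFun_dataMatrix_mulVec (hind : iIndepFun X P) (u : Fin p → ℝ) :
    iIndepFun (fun i ω => (dataMatrix X ω *ᵥ u) i) P := by
  have h := hind.comp (fun _ x => inner ℝ (WithLp.toLp 2 u : EuclideanSpace ℝ (Fin p)) x)
    fun _ => by fun_prop
  convert h using 3 with i ω
  exact dataMatrix_mulVec X _ u i

/-- Finitely many test vectors control the Gram matrices of all designs on the columns in `A`. -/
theorem exists_sparse_test_vectors (hSig : Sig.PosDef) (A : Finset (Fin p)) (n : ℕ) :
    ∃ N : Finset (Fin p → ℝ), N.card ≤ 2 * 25 ^ A.card ∧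
      ∀ D : Matrix (Fin n) (Fin p) ℝ, ∀ c : ℝ, 0 ≤ c →
        (∀ x ∈ N, |(D *ᵥ x) ⬝ᵥ (D *ᵥ x) - n * residualVar Sig x| ≤
          c * (n * residualVar Sig x)) →
        ∀ u : Fin p → ℝ, (∀ i ∉ A, u i = 0) →
          |(D *ᵥ u) ⬝ᵥ (D *ᵥ u) - n * residualVar Sig u| ≤ 4 * c * (n * residualVar Sig u) := by
  classical
  let extend : (A → ℝ) →ₗ[ℝ] (Fin p → ℝ) := Function.ExtendByZero.linearMap ℝ Subtype.val
  have hextend : Function.Injective extend := by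
    intro u v huv
    ext k
    have := congrFun huv k
    simpa [extend, Subtype.val_injective.extend_apply] using this
  let B : (Fin p → ℝ) →ₗ[ℝ] (Fin p → ℝ) →ₗ[ℝ] ℝ := Matrix.toLinearMap₂' ℝ Sig
  have hB : ∀ u v, B u v = u ⬝ᵥ Sig *ᵥ v := fun u v => Matrix.toLinearMap₂'_apply' _ _ _
  obtain ⟨N, hcard, hN⟩ := exists_test_vectors (B.compl₁₂ extend extend)
    (fun u v => by simp [LinearMap.compl₁₂_apply, hB, dotProduct_mulVec_comm hSig])
    (fun u hu => by
      rw [LinearMap.compl₁₂_apply, hB]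
      exact dotProduct_mulVec_pos hSig fun h => hu (hextend (by rw [h, map_zero])))
  refine ⟨N.image extend, ?_, fun D c hc hle u hu => ?_⟩
  · refine Finset.card_image_le.trans (hcard.trans ?_)
    simp
  · let G : (Fin p → ℝ) →ₗ[ℝ] (Fin p → ℝ) →ₗ[ℝ] ℝ := Matrix.toLinearMap₂' ℝ (Dᵀ * D)
    have hG : ∀ u v, G u v = (D *ᵥ u) ⬝ᵥ (D *ᵥ v) := fun u v => by
      rw [show G u v = u ⬝ᵥ (Dᵀ * D) *ᵥ v from Matrix.toLinearMap₂'_apply' _ _ _,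
        ← Matrix.mulVec_mulVec, Matrix.dotProduct_mulVec, Matrix.vecMul_transpose]
    -- The form tested is the fluctuation of the Gram matrix around its mean. The test vectors
    -- depend only on `Sig` and `A`, so they are fixed before the data.
    have h1 := hN ((G - (n : ℝ) • B).compl₁₂ extend extend)
      (fun u v => by
        simp only [LinearMap.compl₁₂_apply, LinearMap.sub_apply, LinearMap.smul_apply, hG, hB]
        rw [dotProduct_comm, dotProduct_mulVec_comm hSig])
      (c * n) (by positivity)
      (fun x hx => by
        have := hle (extend x) (Finset.mem_image_of_mem extend hx)
        simp only [LinearMap.compl₁₂_apply, LinearMap.sub_apply, LinearMap.smul_apply, hG, hB,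
          smul_eq_mul]
        rw [mul_assoc]
        exact this)
      (fun k => u k)
    have hu' : extend (fun k => u k) = u := by
      ext k
      by_cases hk : k ∈ A
      · exact Subtype.val_injective.extend_apply (fun k : A => u k) 0 ⟨k, hk⟩
      · rw [hu k hk]
        exact Function.extend_apply' (f := (Subtype.val : A → Fin p)) (fun k : A => u k) 0 k
          (by rintro ⟨a, rfl⟩; exact hk a.2)
    simp only [LinearMap.compl₁₂_apply, LinearMap.sub_apply, LinearMap.smul_apply, hG, hB,
      smul_eq_mul, hu'] at h1
    rw [residualVar]
    linarith

/-- The Gram matrices of all sets of at most `m` columns are close to their expectations. -/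
def SparseConcentration (Sig : Matrix (Fin p) (Fin p) ℝ) (D : Matrix (Fin n) (Fin p) ℝ)
    (η : ℝ) (m : ℕ) : Prop :=
  ∀ A : Finset (Fin p), A.card ≤ m → ∀ u : Fin p → ℝ, (∀ i ∉ A, u i = 0) →
    |(D *ᵥ u) ⬝ᵥ (D *ᵥ u) - n * residualVar Sig u| ≤ η * (n * residualVar Sig u)

/-- A union bound over supports and test vectors. Each chi-square bound is taken at `η / 4` because
passing from test vectors to all vectors costs a factor 4. -/
theorem measure_not_sparseConcentration_le (hSig : Sig.PosDef)
    (hX : ∀ i, HasLaw (X i) (multivariateGaussian 0 Sig) P) (hind : iIndepFun X P)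
    {η : ℝ} (hη : 0 ≤ η) (hη1 : η ≤ 1) (m : ℕ) :
    P {ω | ¬ SparseConcentration Sig (dataMatrix X ω) η m} ≤
      ENNReal.ofReal ((p + 1) ^ m * (2 * 25 ^ m) *
        (2 * Real.exp (-(n * (η / 4) ^ 2 / 16)))) := by
  classical
  choose N hNcard hN using fun A => exists_sparse_test_vectors hSig A n
  set I := (Finset.univ : Finset (Fin p)).powerset.filter fun S => S.card ≤ m with hI
  set q := ENNReal.ofReal (2 * Real.exp (-(n * (η / 4) ^ 2 / 16))) with hq
  have hsub : {ω | ¬ SparseConcentration Sig (dataMatrix X ω) η m} ⊆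
      ⋃ A ∈ I, ⋃ x ∈ N A, {ω | η / 4 * (n * residualVar Sig x) <
        |(dataMatrix X ω *ᵥ x) ⬝ᵥ (dataMatrix X ω *ᵥ x) - n * residualVar Sig x|} := by
    intro ω hω
    by_contra hc
    simp only [Set.mem_iUnion, not_exists] at hc
    refine hω fun A hA u hu => ?_
    have h1 := hN A (dataMatrix X ω) (η / 4) (by positivity) (fun x hx => by
      have := hc A (Finset.mem_filter.2 ⟨by simp, hA⟩) x hx
      exact not_lt.1 this) u hu
    refine h1.trans_eq (by ring)
  have hone : ∀ x : Fin p → ℝ, P {ω | η / 4 * (n * residualVar Sig x) <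
      |(dataMatrix X ω *ᵥ x) ⬝ᵥ (dataMatrix X ω *ᵥ x) - n * residualVar Sig x|} ≤ q := by
    intro x
    rcases eq_or_ne x 0 with rfl | hx
    · simp [residualVar]
    have hv : 0 < residualVar Sig x := dotProduct_mulVec_pos hSig hx
    have := measure_abs_sum_sq_sub_gt_le (fun i => hasLaw_dataMatrix_mulVec hSig hX x i)
      (iIndepFun_dataMatrix_mulVec hind x) (by simpa using hv) (η := η / 4) (by positivity)
      (by linarith)
    rw [Real.coe_toNNReal _ hv.le] at this
    simpa only [dotProduct, ← pow_two] using this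
  refine (measure_mono hsub).trans ?_
  calc _ ≤ ∑ A ∈ I, P (⋃ x ∈ N A, {ω | η / 4 * (n * residualVar Sig x) <
        |(dataMatrix X ω *ᵥ x) ⬝ᵥ (dataMatrix X ω *ᵥ x) - n * residualVar Sig x|}) :=
        measure_biUnion_finset_le _ _
    _ ≤ ∑ A ∈ I, ((2 * 25 ^ m : ℕ) : ENNReal) * q := by
        refine Finset.sum_le_sum fun A hA => ?_
        refine (measure_biUnion_finset_le _ _).trans ?_
        refine (Finset.sum_le_sum fun x _ => hone x).trans ?_
        rw [Finset.sum_const, nsmul_eq_mul]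
        gcongr
        refine (hNcard A).trans ?_
        gcongr
        · norm_num
        · exact (Finset.mem_filter.1 hA).2
    _ ≤ ((p + 1) ^ m : ℕ) * (((2 * 25 ^ m : ℕ) : ENNReal) * q) := by
        rw [Finset.sum_const, nsmul_eq_mul]
        gcongr
        have := card_filter_card_le (Finset.univ : Finset (Fin p)) m
        rwa [Finset.card_univ, Fintype.card_fin] at this
    _ = _ := by
        rw [hq, ← ENNReal.ofReal_natCast, ← ENNReal.ofReal_natCast,
          ← ENNReal.ofReal_mul (by positivity), ← ENNReal.ofReal_mul (by positivity), ← mul_assoc]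
        push_cast
        rfl

/-! ### The noise -/

/-- The matrix `D` with the columns outside `K` replaced by zero. -/
def maskCols (K : Finset (Fin p)) (D : Matrix (Fin n) (Fin p) ℝ) : Matrix (Fin n) (Fin p) ℝ :=
  Matrix.of fun i k => if k ∈ K then D i k else 0

/-- Exhibits the residual as a function of the columns in `K` alone, the form in which independence
of the noise applies. -/
theorem residual_maskCols {K S : Finset (Fin p)} (hS : S ⊆ K) {k : Fin p} (hk : k ∈ K)
    (D : Matrix (Fin n) (Fin p) ℝ) :
    residual (maskCols K D) S ((maskCols K D).col k) = residual D S (D.col k) := by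
  have h1 : cols (maskCols K D) S = cols D S := by
    ext i l
    simp [cols, maskCols, hS l.2]
  have h2 : (maskCols K D).col k = D.col k := by
    ext i
    simp [maskCols, hk]
  rw [residual, residual, mulVec_olsCoef, mulVec_olsCoef, h1, h2]

/-- The matrix inverse is not continuous at singular matrices, but the adjugate divided by the
determinant is measurable everywhere. -/
theorem measurable_residual_col (S : Finset (Fin p)) (k : Fin p) :
    Measurable fun y : Fin n → Fin p → ℝ =>
      residual (Matrix.of y) S ((Matrix.of y).col k) := by
  have hcols : Continuous fun y : Fin n → Fin p → ℝ => cols (Matrix.of y) S := by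
    refine continuous_matrix fun i l => ?_
    simp only [cols, Matrix.submatrix_apply, Matrix.of_apply]
    fun_prop
  have hgram : Continuous fun y : Fin n → Fin p → ℝ =>
      (cols (Matrix.of y) S)ᵀ * cols (Matrix.of y) S := hcols.matrix_transpose.matrix_mul hcols
  have hinv : ∀ a b, Measurable fun y : Fin n → Fin p → ℝ =>
      ((cols (Matrix.of y) S)ᵀ * cols (Matrix.of y) S)⁻¹ a b := by
    intro a b
    simp only [Matrix.inv_def, Matrix.smul_apply, Ring.inverse_eq_inv', smul_eq_mul]
    exact hgram.matrix_det.measurable.inv.mul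
      ((hgram.matrix_adjugate.matrix_elem a b).measurable)
  refine measurable_pi_lambda _ fun i => ?_
  simp only [residual, mulVec_olsCoef, Pi.sub_apply, Matrix.mulVec, dotProduct]
  refine Measurable.sub ?_ (Finset.measurable_sum _ fun a _ => Measurable.mul ?_
    (Finset.measurable_sum _ fun b _ => (hinv a b).mul
      (Finset.measurable_sum _ fun l _ => Measurable.mul ?_ ?_)))
  · simp only [Matrix.col_apply, Matrix.of_apply]; fun_prop
  · simp only [cols, Matrix.submatrix_apply, Matrix.of_apply]; fun_prop
  · simp only [cols, Matrix.transpose_apply, Matrix.submatrix_apply, Matrix.of_apply]; fun_prop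
  · simp only [Matrix.col_apply, Matrix.of_apply]; fun_prop

/-- The noise `Xb` is independent of the columns with which it is uncorrelated. -/
theorem indepFun_noise (hSig : Sig.PosDef)
    (hX : ∀ i, HasLaw (X i) (multivariateGaussian 0 Sig) P) (hind : iIndepFun X P)
    {K : Finset (Fin p)} {b : Fin p → ℝ} (hb : ∀ k ∈ K, (Sig *ᵥ b) k = 0) :
    IndepFun (fun ω (a : Fin n × Fin p) => maskCols K (dataMatrix X ω) a.1 a.2)
      (fun ω i => (dataMatrix X ω *ᵥ b) i) P := by
  have hP : IsProbabilityMeasure P := hind.isProbabilityMeasure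
  have hjoint := hind.hasGaussianLaw fun i => (hX i).hasGaussianLaw
  have hcoord : ∀ i k, ∀ ω, dataMatrix X ω i k =
      inner ℝ (WithLp.toLp 2 (Pi.single k 1) : EuclideanSpace ℝ (Fin p)) (X i ω) := fun i k ω => by
    rw [← dataMatrix_mulVec, mulVec_single_one, Matrix.col_apply]
  have hmem : ∀ i (u : EuclideanSpace ℝ (Fin p)), MemLp (fun ω => inner ℝ u (X i ω)) 2 P :=
    fun i u => ((hX i).hasGaussianLaw.map (innerSL ℝ u)).memLp_two
  refine HasGaussianLaw.indepFun_of_covariance_eval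
    (X := fun (a : Fin n × Fin p) ω => maskCols K (dataMatrix X ω) a.1 a.2)
    (Y := fun i ω => (dataMatrix X ω *ᵥ b) i) ?_ ?_
  -- Design and noise together are a linear image of the jointly Gaussian rows, so vanishing
  -- covariances imply independence.
  · let L : (Fin n → EuclideanSpace ℝ (Fin p)) →L[ℝ] (Fin n × Fin p → ℝ) × (Fin n → ℝ) :=
      (ContinuousLinearMap.pi fun a : Fin n × Fin p =>
        if a.2 ∈ K then (innerSL ℝ (WithLp.toLp 2 (Pi.single a.2 1) :
          EuclideanSpace ℝ (Fin p))).comp (ContinuousLinearMap.proj a.1) else 0).prod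
      (ContinuousLinearMap.pi fun i =>
        (innerSL ℝ (WithLp.toLp 2 b : EuclideanSpace ℝ (Fin p))).comp
          (ContinuousLinearMap.proj i))
    refine (hjoint.map_fun L).congr (ae_of_all _ fun ω => Prod.ext ?_ ?_)
    · ext a
      by_cases ha : a.2 ∈ K
      · simp only [L, maskCols, Matrix.of_apply, ha, if_true, ContinuousLinearMap.prod_apply,
          ContinuousLinearMap.coe_pi', hcoord]
        rfl
      · simp [L, maskCols, ha]
    · ext i
      exact (dataMatrix_mulVec X ω b i).symm
  · rintro ⟨i, k⟩ i'
    by_cases hk : k ∈ K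
    · simp only [maskCols, Matrix.of_apply, hk, if_true, hcoord, dataMatrix_mulVec]
      -- Within one row the covariance is the `k`-th entry of `Sig *ᵥ b`, which is zero; distinct
      -- rows are independent.
      by_cases hii : i = i'
      · subst hii
        have h1 := covariance_map_fun (μ := P) (Z := X i)
          (X := fun z => inner ℝ (WithLp.toLp 2 (Pi.single k 1) : EuclideanSpace ℝ (Fin p)) z)
          (Y := fun z => inner ℝ (WithLp.toLp 2 b : EuclideanSpace ℝ (Fin p)) z)
          (by fun_prop) (by fun_prop) (hX i).aemeasurable
        rw [← h1, (hX i).map_eq, ← covarianceBilin_apply_eq_cov IsGaussian.memLp_two_id,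
          covarianceBilin_multivariateGaussian hSig.posSemidef]
        simpa using hb k hk
      · have h1 := (hind.indepFun hii).comp
          (φ := fun z => inner ℝ (WithLp.toLp 2 (Pi.single k 1) : EuclideanSpace ℝ (Fin p)) z)
          (ψ := fun z => inner ℝ (WithLp.toLp 2 b : EuclideanSpace ℝ (Fin p)) z)
          (by fun_prop) (by fun_prop)
        exact h1.covariance_eq_zero (hmem i _) (hmem i' _)
    · simp [maskCols, hk, covariance]

/-- By independence the joint law is a product. For each fixed design the residual is a
deterministic vector, the Gaussian tail bound holds uniformly, and integration over the design
preserves it. -/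
theorem measure_noise_gt_le (hSig : Sig.PosDef)
    (hX : ∀ i, HasLaw (X i) (multivariateGaussian 0 Sig) P) (hind : iIndepFun X P)
    {S : Finset (Fin p)} {k : Fin p} {b : Fin p → ℝ} (hb0 : b ≠ 0)
    (hb : ∀ l ∈ insert k S, (Sig *ᵥ b) l = 0) {s : ℝ} (hs : 0 ≤ s) :
    P {ω | residualVar Sig b * s *
        (residual (dataMatrix X ω) S ((dataMatrix X ω).col k) ⬝ᵥ
          residual (dataMatrix X ω) S ((dataMatrix X ω).col k)) <
      ((dataMatrix X ω *ᵥ b) ⬝ᵥ residual (dataMatrix X ω) S ((dataMatrix X ω).col k)) ^ 2} ≤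
      ENNReal.ofReal (2 * Real.exp (-(s / 2))) := by
  have hP : IsProbabilityMeasure P := hind.isProbabilityMeasure
  have hv : 0 < residualVar Sig b := dotProduct_mulVec_pos hSig hb0
  set Y : Ω → (Fin n × Fin p → ℝ) :=
    fun ω a => maskCols (insert k S) (dataMatrix X ω) a.1 a.2 with hY
  set ε : Ω → (Fin n → ℝ) := fun ω i => (dataMatrix X ω *ᵥ b) i with hε
  set F : (Fin n × Fin p → ℝ) → (Fin n → ℝ) := fun y =>
    residual (Matrix.of fun i l => y (i, l)) S ((Matrix.of fun i l => y (i, l)).col k) with hF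
  have hFm : Measurable F :=
    (measurable_residual_col S k).comp (g := fun y : Fin n → Fin p → ℝ =>
      residual (Matrix.of y) S ((Matrix.of y).col k))
      (f := fun (y : Fin n × Fin p → ℝ) i l => y (i, l)) (by fun_prop)
  have hFY : ∀ ω, F (Y ω) = residual (dataMatrix X ω) S ((dataMatrix X ω).col k) := fun ω =>
    residual_maskCols (Finset.subset_insert k S) (Finset.mem_insert_self k S) _
  have hXm : ∀ i, AEMeasurable (X i) P := fun i => (hX i).aemeasurable
  have hYm : AEMeasurable Y P := by
    refine aemeasurable_pi_lambda _ fun a => ?_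
    simp only [hY, maskCols, Matrix.of_apply, dataMatrix]
    split_ifs
    · have := hXm a.1; fun_prop
    · fun_prop
  have hεm : AEMeasurable ε P := aemeasurable_pi_lambda _ fun i =>
    (hasLaw_dataMatrix_mulVec hSig hX b i).aemeasurable
  have hI := (indepFun_iff_map_prod_eq_prod_map_map hYm hεm).1 (indepFun_noise hSig hX hind hb)
  set E : Set ((Fin n × Fin p → ℝ) × (Fin n → ℝ)) :=
    {z | residualVar Sig b * s * (F z.1 ⬝ᵥ F z.1) < (z.2 ⬝ᵥ F z.1) ^ 2} with hE
  have hEm : MeasurableSet E := by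
    refine measurableSet_lt ?_ ?_ <;> simp only [dotProduct] <;> fun_prop
  have hset : {ω | residualVar Sig b * s *
        (residual (dataMatrix X ω) S ((dataMatrix X ω).col k) ⬝ᵥ
          residual (dataMatrix X ω) S ((dataMatrix X ω).col k)) <
      ((dataMatrix X ω *ᵥ b) ⬝ᵥ residual (dataMatrix X ω) S ((dataMatrix X ω).col k)) ^ 2} =
      (fun ω => (Y ω, ε ω)) ⁻¹' E := by
    ext ω
    simp only [hE, Set.mem_preimage, Set.mem_ofPred_eq, hFY, hε]
  have : IsProbabilityMeasure (P.map Y) := Measure.isProbabilityMeasure_map hYm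
  rw [hset, ← Measure.map_apply_of_aemeasurable (hYm.prodMk hεm) hEm, hI,
    Measure.prod_apply hEm]
  calc _ ≤ ∫⁻ _, ENNReal.ofReal (2 * Real.exp (-(s / 2))) ∂(P.map Y) := by
        refine lintegral_mono fun y => ?_
        rw [Measure.map_apply_of_aemeasurable hεm (measurable_prodMk_left hEm)]
        have := measure_sq_dotProduct_gt_le (fun i => hasLaw_dataMatrix_mulVec hSig hX b i)
          (iIndepFun_dataMatrix_mulVec hind b) (by simpa using hv) (F y) hs
        rw [Real.coe_toNNReal _ hv.le] at this
        exact this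
    _ = _ := by simp

end Design

/-! ### The favourable event -/

section Event

variable {n p : ℕ} {Sig : Matrix (Fin p) (Fin p) ℝ}

/-- The sets of at most `d` nodes other than `j`. -/
def smallSets (j : Fin p) (d : ℕ) : Finset (Finset (Fin p)) :=
  (Finset.univ.erase j).powerset.filter fun S => S.card ≤ d

theorem card_smallSets_le (j : Fin p) (d : ℕ) : (smallSets j d).card ≤ p ^ d := by
  have h := card_filter_card_le (Finset.univ.erase j) d
  have hp : 0 < p := j.pos
  rwa [Finset.card_erase_of_mem (Finset.mem_univ j), Finset.card_univ, Fintype.card_fin,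
    Nat.sub_add_cancel hp] at h

theorem mem_smallSets {j : Fin p} {d : ℕ} {S : Finset (Fin p)} (hj : j ∉ S) (hS : S.card ≤ d) :
    S ∈ smallSets j d := by
  refine Finset.mem_filter.2 ⟨Finset.mem_powerset.2 fun i hi => ?_, hS⟩
  exact Finset.mem_erase.2 ⟨fun e => hj (e ▸ hi), Finset.mem_univ i⟩

theorem notMem_of_mem_smallSets {j : Fin p} {d : ℕ} {S : Finset (Fin p)}
    (hS : S ∈ smallSets j d) : j ∉ S := fun hj =>
  Finset.notMem_erase j _ (Finset.mem_powerset.1 (Finset.mem_filter.1 hS).1 hj)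

/-- All projections of population residuals on residuals of columns with which they are
uncorrelated are small. -/
def NoiseBound (Sig : Matrix (Fin p) (Fin p) ℝ) (D : Matrix (Fin n) (Fin p) ℝ) (d : ℕ)
    (s : ℝ) : Prop :=
  ∀ j, ∀ A ∈ smallSets j d, ∀ S ∈ smallSets j d, ∀ k,
    (∀ l ∈ insert k S, (Sig *ᵥ popResidual Sig j A) l = 0) →
    ((D *ᵥ popResidual Sig j A) ⬝ᵥ residual D S (D.col k)) ^ 2 ≤
      residualVar Sig (popResidual Sig j A) * s *
        (residual D S (D.col k) ⬝ᵥ residual D S (D.col k))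

/-- A union bound over `j`, `A`, `S`, `k`. Indexing by parent sets `A` rather than by orderings
keeps the count polynomial for fixed `d`. -/
theorem measure_not_noiseBound_le {Ω : Type*} [MeasurableSpace Ω] {P : Measure Ω}
    {X : Fin n → Ω → EuclideanSpace ℝ (Fin p)} (hSig : Sig.PosDef)
    (hX : ∀ i, HasLaw (X i) (multivariateGaussian 0 Sig) P) (hind : iIndepFun X P) (d : ℕ)
    {s : ℝ} (hs : 0 ≤ s) :
    P {ω | ¬ NoiseBound Sig (dataMatrix X ω) d s} ≤
      ENNReal.ofReal (p ^ (2 * d + 2) * (2 * Real.exp (-(s / 2)))) := by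
  classical
  set q := ENNReal.ofReal (2 * Real.exp (-(s / 2))) with hq
  set bad : Fin p → Finset (Fin p) → Finset (Fin p) → Fin p → Set Ω := fun j A S k =>
    {ω | (∀ l ∈ insert k S, (Sig *ᵥ popResidual Sig j A) l = 0) ∧
      residualVar Sig (popResidual Sig j A) * s *
        (residual (dataMatrix X ω) S ((dataMatrix X ω).col k) ⬝ᵥ
          residual (dataMatrix X ω) S ((dataMatrix X ω).col k)) <
      ((dataMatrix X ω *ᵥ popResidual Sig j A) ⬝ᵥ
        residual (dataMatrix X ω) S ((dataMatrix X ω).col k)) ^ 2} with hbad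
  have hsub : {ω | ¬ NoiseBound Sig (dataMatrix X ω) d s} ⊆
      ⋃ j ∈ (Finset.univ : Finset (Fin p)), ⋃ A ∈ smallSets j d, ⋃ S ∈ smallSets j d,
        ⋃ k ∈ (Finset.univ : Finset (Fin p)), bad j A S k := by
    intro ω hω
    by_contra hc
    simp only [Set.mem_iUnion, not_exists] at hc
    refine hω fun j A hA S hS k hl => ?_
    by_contra hlt
    exact hc j (Finset.mem_univ j) A hA S hS k (Finset.mem_univ k) ⟨hl, not_le.1 hlt⟩
  have hone : ∀ j, ∀ A ∈ smallSets j d, ∀ S k, P (bad j A S k) ≤ q := by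
    intro j A hA S k
    by_cases hl : ∀ l ∈ insert k S, (Sig *ᵥ popResidual Sig j A) l = 0
    · have hb0 : popResidual Sig j A ≠ 0 := fun h0 => by
        have h1 := congrFun h0 j
        simp [popResidual, popCoef_of_notMem Sig j (notMem_of_mem_smallSets hA)] at h1
      refine (measure_mono fun ω hω => ?_).trans (measure_noise_gt_le hSig hX hind hb0 hl hs)
      exact hω.2
    -- Orthogonality is a deterministic condition; where it fails, `NoiseBound` claims nothing.
    · have : bad j A S k = ∅ := Set.eq_empty_of_forall_notMem fun ω hω => hl hω.1
      rw [this]; simp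
  refine (measure_mono hsub).trans ?_
  calc _ ≤ ∑ j : Fin p, ∑ A ∈ smallSets j d, ∑ S ∈ smallSets j d, ∑ k : Fin p,
        P (bad j A S k) := by
        refine (measure_biUnion_finset_le _ _).trans (Finset.sum_le_sum fun j _ => ?_)
        refine (measure_biUnion_finset_le _ _).trans (Finset.sum_le_sum fun A _ => ?_)
        refine (measure_biUnion_finset_le _ _).trans (Finset.sum_le_sum fun S _ => ?_)
        exact measure_biUnion_finset_le _ _
    _ ≤ ∑ j : Fin p, ∑ A ∈ smallSets j d, ∑ S ∈ smallSets j d, ∑ k : Fin p, q :=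
        Finset.sum_le_sum fun j _ => Finset.sum_le_sum fun A hA => Finset.sum_le_sum fun S _ =>
          Finset.sum_le_sum fun k _ => hone j A hA S k
    _ ≤ ∑ j : Fin p, ((p ^ d : ℕ) : ENNReal) * (((p ^ d : ℕ) : ENNReal) * (p * q)) := by
        refine Finset.sum_le_sum fun j _ => ?_
        simp only [Finset.sum_const, nsmul_eq_mul, Finset.card_univ, Fintype.card_fin]
        have := card_smallSets_le j d
        gcongr
    _ = _ := by
        simp only [Finset.sum_const, nsmul_eq_mul, Finset.card_univ, Fintype.card_fin]
        rw [hq, ← ENNReal.ofReal_natCast, ← ENNReal.ofReal_natCast,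
          ← ENNReal.ofReal_mul (by positivity), ← ENNReal.ofReal_mul (by positivity),
          ← ENNReal.ofReal_mul (by positivity), ← ENNReal.ofReal_mul (by positivity)]
        congr 1
        push_cast
        ring

theorem cholResidual_self (σ : Equiv.Perm (Fin p)) (j : Fin p) : cholResidual Sig σ j j = 1 := by
  simp [cholResidual, cholFactor_eq_zero Sig σ j j le_rfl]

theorem cholResidual_add (σ : Equiv.Perm (Fin p)) (j : Fin p) :
    cholResidual Sig σ j + (cholFactor Sig σ).col j = Pi.single j 1 := by
  simp [cholResidual]

/-- On the favourable event every node satisfies the assumptions of the analysis of the moves. -/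
theorem nodeModel_of_event (hSig : Sig.PosDef) {D : Matrix (Fin n) (Fin p) ℝ} {d : ℕ}
    {s lo hi δ η : ℝ} (hn : 0 < n) (hs : 0 ≤ s) (hlo : 0 < lo) (hhi : 0 < hi) (hδ : 0 < δ ∧ δ < 1)
    (hA : ∀ lam ∈ spectrum ℝ Sig, lo / (1 - δ) ^ 2 ≤ lam ∧ lam ≤ hi / (1 + δ) ^ 2)
    (hη0 : 0 ≤ η) (hηδ : η ≤ δ) (hη : η ≤ 1 / 2)
    (hconc : SparseConcentration Sig D η (2 * d + 1)) (hnoise : NoiseBound Sig D d s)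
    (σ : Equiv.Perm (Fin p)) (j : Fin p) (hcard : (trueParents Sig σ j).card ≤ d) {b : ℝ}
    (hb : ∀ i ∈ trueParents Sig σ j, b ≤ cholFactor Sig σ i j ^ 2) :
    NodeModel D j (predecessors σ j) (trueParents Sig σ j) ((cholFactor Sig σ).col j)
      (residualVar Sig (cholResidual Sig σ j)) lo hi s b d := by
  have hn' : (0 : ℝ) < n := by exact_mod_cast hn
  have h1δ : 0 < 1 - δ := by linarith [hδ.2]
  have hj : j ∉ predecessors σ j := by simp [mem_predecessors]
  have hQ : ∀ u, lo ≤ (1 - η) * (lo / (1 - δ) ^ 2) ∧ (1 + η) * (hi / (1 + δ) ^ 2) ≤ hi ∧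
      lo / (1 - δ) ^ 2 * (u ⬝ᵥ u) ≤ residualVar Sig u ∧
      residualVar Sig u ≤ hi / (1 + δ) ^ 2 * (u ⬝ᵥ u) := by
    intro u
    refine ⟨?_, ?_, residualVar_bounds hSig hA u⟩
    · rw [mul_div_assoc', le_div_iff₀ (by positivity)]
      -- The slack (1 - δ)² in assumption (A) absorbs the sampling error η ≤ δ.
      have : (1 - δ) ^ 2 ≤ 1 - η := by nlinarith [hδ.1]
      nlinarith
    · rw [mul_div_assoc', div_le_iff₀ (by nlinarith [hδ.1])]
      have : 1 + η ≤ (1 + δ) ^ 2 := by nlinarith [hδ.1]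
      nlinarith
  have hhi' : hi / (1 + δ) ^ 2 ≤ hi := by
    exact div_le_self hhi.le (one_le_pow₀ (by linarith [hδ.1]))
  have hlo' : lo ≤ lo / (1 - δ) ^ 2 := by
    rw [le_div_iff₀ (by positivity)]
    exact mul_le_of_le_one_right hlo.le (pow_le_one₀ h1δ.le (by linarith [hδ.1]))
  have hcols : D.col j - D *ᵥ (cholFactor Sig σ).col j = D *ᵥ cholResidual Sig σ j := by
    rw [cholResidual, Matrix.mulVec_sub, mulVec_single_one]
  have horth : ∀ k ∈ predecessors σ j, (Sig *ᵥ cholResidual Sig σ j) k = 0 := fun k hk =>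
    cholResidual_orthogonal hSig σ j hk
  have hβ : ∀ i ∉ predecessors σ j, (cholFactor Sig σ).col j i = 0 := fun i hi =>
    cholFactor_eq_zero Sig σ i j (not_lt.1 (mem_predecessors.not.1 hi))
  have hω : 0 < residualVar Sig (cholResidual Sig σ j) :=
    dotProduct_mulVec_pos hSig fun h0 => by
      have := cholResidual_self (Sig := Sig) σ j
      rw [h0] at this
      simp at this
  have heig : SparseEigenvalues D n lo hi (2 * d + 1) := by
    intro A hA' u hu
    have h1 := abs_le.1 (hconc A hA' u hu)
    obtain ⟨q1, q2, q3, q4⟩ := hQ u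
    have hu0 := dotProduct_self_nonneg' u
    constructor
    · calc n * lo * (u ⬝ᵥ u) ≤ n * ((1 - η) * (lo / (1 - δ) ^ 2)) * (u ⬝ᵥ u) := by gcongr
        _ = n * (1 - η) * (lo / (1 - δ) ^ 2 * (u ⬝ᵥ u)) := by ring
        _ ≤ n * (1 - η) * residualVar Sig u := by
            have : 0 ≤ 1 - η := by linarith
            gcongr
        _ ≤ _ := by linarith
    · calc _ ≤ n * (1 + η) * residualVar Sig u := by linarith
        _ ≤ n * (1 + η) * (hi / (1 + δ) ^ 2 * (u ⬝ᵥ u)) := by gcongr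
        _ = n * ((1 + η) * (hi / (1 + δ) ^ 2)) * (u ⬝ᵥ u) := by ring
        _ ≤ _ := by gcongr
  refine
    { notMem := hj
      subset := trueParents_subset σ j
      support := fun i hi => cholFactor_of_notMem hi
      lo_pos := hlo
      lo_le_hi := ?_
      ω_pos := hω
      ω_le := ?_
      noise_nonneg := hs
      card_le := hcard
      n_pos := hn
      eig := heig
      noise_le := ?_
      le_rss := ?_
      beta_min := hb }
  · obtain ⟨-, -, q3, q4⟩ := hQ (Pi.single j 1)
    have : (Pi.single j 1 : Fin p → ℝ) ⬝ᵥ Pi.single j 1 = 1 := by simp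
    rw [this] at q3 q4
    linarith
  -- The variance of `X_j` is the residual variance plus that of its predictor, so it bounds the
  -- former.
  · obtain ⟨-, -, q3, q4⟩ := hQ (Pi.single j 1)
    have h1 : (Pi.single j 1 : Fin p → ℝ) ⬝ᵥ Pi.single j 1 = 1 := by simp
    have h2 := residualVar_add hSig horth hβ
    rw [cholResidual_add] at h2
    have h3 := residualVar_nonneg hSig ((cholFactor Sig σ).col j)
    rw [h1] at q4
    linarith
  · intro S hS hSd k hk
    -- Removes the ordering from the noise vector, which is what brings it within reach of
    -- `NoiseBound`.
    rw [hcols, cholResidual_eq_popResidual hSig]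
    refine hnoise j _ (mem_smallSets (fun h => hj (trueParents_subset σ j h)) hcard) S
      (mem_smallSets (fun h => hj (hS h)) hSd) k fun l hl => ?_
    rw [← cholResidual_eq_popResidual hSig]
    rcases Finset.mem_insert.1 hl with rfl | hl
    · exact horth _ hk
    · exact horth _ (hS hl)
  · intro S hS hSd
    have hf : FullRankOn D S := heig.fullRankOn hn' hlo (by omega)
    rw [rss_eq_dotProduct_self hf, residual_col]
    set c := olsCoef D S (D.col j) with hc
    have hcS : ∀ i ∉ S, c i = 0 := fun i hi => olsCoef_of_notMem D _ hi
    have h1 := (abs_le.1 (hconc (insert j S) ((Finset.card_insert_le _ _).trans (by omega))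
      (Pi.single j 1 - c) fun i hi => by
        have := Finset.mem_insert.not.1 hi
        push Not at this
        simp [hcS i this.2, this.1])).1
    -- No predictor using predecessors beats the population one, so the population variance of the
    -- fitted residual is at least `ω`; concentration with `η ≤ 1/2` keeps half of it.
    have h2 : Pi.single j 1 - c = cholResidual Sig σ j + ((cholFactor Sig σ).col j - c) := by
      rw [← cholResidual_add (Sig := Sig) σ j]; abel
    have h3 := residualVar_add hSig horth (u := (cholFactor Sig σ).col j - c) fun i hi => by
      rw [Pi.sub_apply, hβ i hi, hcS i fun h => hi (hS h), sub_zero]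
    rw [← h2] at h3
    have h4 := residualVar_nonneg hSig ((cholFactor Sig σ).col j - c)
    have h5 : residualVar Sig (cholResidual Sig σ j) ≤ residualVar Sig (Pi.single j 1 - c) := by
      linarith
    calc n * residualVar Sig (cholResidual Sig σ j) / 2
        = (1 / 2) * (n * residualVar Sig (cholResidual Sig σ j)) := by ring
      _ ≤ (1 - η) * (n * residualVar Sig (Pi.single j 1 - c)) := by
          have : 1 / 2 ≤ 1 - η := by linarith
          gcongr
      _ ≤ _ := by linarith

/-! ### Asymptotics of the failure probabilities -/

/-- Bounding every factor by a power of p gives p^(14d+9), and 14d + 10 ≤ 24d for d ≥ 1; hence the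
24. -/
theorem concentration_failure_le {p d n : ℕ} {c : ℝ} (hp : 2 ≤ p) (hd : 1 ≤ d)
    (h : 24 * (d * Real.log p) ≤ n * c) :
    ((p : ℝ) + 1) ^ (2 * d + 1) * (2 * 25 ^ (2 * d + 1)) * (2 * Real.exp (-(n * c))) ≤
      (p : ℝ)⁻¹ := by
  have hp' : (2 : ℝ) ≤ p := by exact_mod_cast hp
  have hp0 : (0 : ℝ) < p := by linarith
  have h1 : (p : ℝ) + 1 ≤ p ^ 2 := by nlinarith
  have h2 : (25 : ℝ) ≤ p ^ 5 := by
    calc (25 : ℝ) ≤ 2 ^ 5 := by norm_num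
      _ ≤ p ^ 5 := by gcongr
  have h3 : (2 : ℝ) * 2 ≤ p ^ 2 := by nlinarith
  have h4 : Real.exp (-(n * c)) ≤ ((p : ℝ) ^ (24 * d))⁻¹ := by
    rw [← Real.exp_log (show (0 : ℝ) < ((p : ℝ) ^ (24 * d))⁻¹ by positivity), Real.log_inv,
      Real.log_pow]
    refine Real.exp_le_exp.2 ?_
    push_cast
    linarith
  calc _ = (((p : ℝ) + 1) ^ (2 * d + 1) * 25 ^ (2 * d + 1)) * (2 * 2) * Real.exp (-(n * c)) := by
        ring
    _ ≤ (((p : ℝ) ^ 2) ^ (2 * d + 1) * (p ^ 5) ^ (2 * d + 1)) * p ^ 2 *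
        ((p : ℝ) ^ (24 * d))⁻¹ := by gcongr
    _ = p ^ (14 * d + 9) * ((p : ℝ) ^ (24 * d))⁻¹ := by ring
    _ ≤ (p : ℝ)⁻¹ := by
        rw [← div_eq_mul_inv, div_le_iff₀ (by positivity), ← div_eq_inv_mul,
          le_div_iff₀ hp0, ← pow_succ]
        exact pow_le_pow_right₀ (by linarith) (by omega)

/-- The level (4d + 6) log p is chosen so that the tail p^{-(2d+3)} beats the p^(2d+2) choices by
one factor of p. -/
theorem noise_failure_eq {p d : ℕ} (hp : 1 ≤ p) :
    (p : ℝ) ^ (2 * d + 2) * (2 * Real.exp (-((4 * d + 6) * Real.log p / 2))) =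
      2 * (p : ℝ)⁻¹ := by
  have hp0 : (0 : ℝ) < p := by exact_mod_cast hp
  have h : Real.exp (-((4 * d + 6) * Real.log p / 2)) = ((p : ℝ) ^ (2 * d + 3))⁻¹ := by
    rw [← Real.exp_log (show (0 : ℝ) < ((p : ℝ) ^ (2 * d + 3))⁻¹ by positivity), Real.log_inv,
      Real.log_pow]
    push_cast
    congr 1
    ring
  rw [h]
  field_simp
  ring

end Event

end DagSel

end

/-! ### Assembly of the theorem -/

open DagSel
theorem theorem3
    -- dimension, sparsity bounds and hyperparameters, for each sample size `n`
    (p din dout : ℕ → ℕ) (H : ℕ → Hyper)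
    (hp : Tendsto p atTop atTop)
    (hdin : ∀ n, 1 ≤ din n ∧ din n ≤ p n)
    (hdout : ∀ n, 1 ≤ dout n ∧ dout n ≤ p n)
    (hc₁ : ∀ n, 0 < (H n).c₁) (hc₂ : ∀ n, 0 ≤ (H n).c₂)
    (hα : ∀ n, 0 < (H n).α ∧ (H n).α < 1)
    (hγ : ∀ n, 0 < (H n).γ) (hκ : ∀ n, 0 ≤ (H n).κ)
    -- true covariance matrix; the rows of the data matrix are i.i.d. `N(0, Sig n)`
    (Sig : (n : ℕ) → Matrix (Fin (p n)) (Fin (p n)) ℝ)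
    (hSig : ∀ n, (Sig n).PosDef)
    {Ω : ℕ → Type*} [∀ n, MeasurableSpace (Ω n)]
    (P : (n : ℕ) → Measure (Ω n)) [∀ n, IsProbabilityMeasure (P n)]
    (X : (n : ℕ) → Fin n → Ω n → EuclideanSpace ℝ (Fin (p n)))
    (hXlaw : ∀ n i, HasLaw (X n i) (multivariateGaussian 0 (Sig n)) (P n))
    (hXindep : ∀ n, iIndepFun (X n) (P n))
    -- Assumption A: all eigenvalues of `Sig n` lie between `νlo / (1 - δ₀)²` and `νhi / (1 + δ₀)²`
    (νlo νhi : ℕ → ℝ) (hνlo : ∀ n, 0 < νlo n) (hνhi : ∀ n, 0 < νhi n)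
    (δ₀ : ℝ) (hδ₀ : 0 < δ₀ ∧ δ₀ < 1)
    (hA : ∀ n, ∀ lam ∈ spectrum ℝ (Sig n),
      νlo n / (1 - δ₀) ^ 2 ≤ lam ∧ lam ≤ νhi n / (1 + δ₀) ^ 2)
    -- Assumption B
    (hB : (fun n => (din n : ℝ) * Real.log (p n)) =o[atTop] fun n => (n : ℝ))
    -- Assumption C
    (t : ℝ) (ht : 0 < t)
    (hCκ : ∀ n, (H n).κ ≤ n)
    (hCc₁ : ∀ n, 1 ≤ (H n).c₁ * √(1 + (H n).α / (H n).γ) ∧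
      (H n).c₁ * √(1 + (H n).α / (H n).γ) ≤ p n)
    (hCc₂ : ∀ n, ((H n).α + 1) * (4 * din n + 6) + t ≤ (H n).c₂)
    -- Assumption DP
    (hDP : ∀ n, (4 * νhi n ^ 2 * (νlo n ^ 4)⁻¹ * (νhi n - νlo n) ^ 2 + 1) * dStar (Sig n) ≤ din n)
    -- Assumption EP
    (Cβ : ℝ) (hCβ : 0 < Cβ)
    (hEP : ∀ n, ∀ σ : Equiv.Perm (Fin (p n)), ∀ i j, cholFactor (Sig n) σ i j ≠ 0 →
      5 * (Cβ + 4 * (H n).c₂) * (νhi n ^ 2 * Real.log (p n) / ((H n).α * νlo n ^ 2 * n)) ≤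
        |cholFactor (Sig n) σ i j| ^ 2)
    (hCβt : 8 * t / 3 ≤ Cβ) :
    ∀ᶠ n in atTop,
      ENNReal.ofReal (1 - 3 * (p n : ℝ)⁻¹) ≤ P n {ω |
        let D : Matrix (Fin n) (Fin (p n)) ℝ := Matrix.of fun i k => X n i ω k
        -- (i)
        (∀ (σ : Equiv.Perm (Fin (p n))) (j : Fin (p n)), ∀ S ∈ candidates σ j (din n),
          S ≠ trueParents (Sig n) σ j →
            t * Real.log (p n) ≤
              nodeScore (H n) D j (nodeTransition (Sig n) (H n) D (din n) σ j S) -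
                nodeScore (H n) D j S) ∧
        -- (ii)
        (2 < t → ∀ (σ : Equiv.Perm (Fin (p n))) (j : Fin (p n)),
          1 - (p n : ℝ) ^ (-(t - 2)) ≤
            Real.exp (nodeScore (H n) D j (trueParents (Sig n) σ j)) /
              ∑ S ∈ candidates σ j (din n), Real.exp (nodeScore (H n) D j S)) ∧
        -- (iii)
        (3 < t → ∀ σ : Equiv.Perm (Fin (p n)),
          1 - (p n : ℝ) ^ (-(t - 3)) ≤
            Real.exp (score (H n) D (minimalIMap (Sig n) σ)) /
              ∑ G ∈ sparseDAGs σ (din n) (dout n), Real.exp (score (H n) D G))} := by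
  -- The tolerance must stay within the eigenvalue slack δ₀ and leave at least half of every
  -- residual variance.
  have hη0 : 0 < min δ₀ (1 / 2) := lt_min hδ₀.1 (by norm_num)
  set η := min δ₀ (1 / 2) with hηdef
  have hηδ : η ≤ δ₀ := min_le_left _ _
  have hη2 : η ≤ 1 / 2 := min_le_right _ _
  have hc : 0 < (η / 4) ^ 2 / 16 := by positivity
  filter_upwards [hp.eventually_ge_atTop 2, eventually_ge_atTop 1,
    hB.bound (show 0 < (η / 4) ^ 2 / 16 / 24 by positivity)] with n hpn hn hBn
  have hp1 : 1 ≤ p n := by omega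
  have hpR : (0 : ℝ) < p n := by exact_mod_cast hp1
  have hL : 0 ≤ Real.log (p n) := Real.log_nonneg (by exact_mod_cast hp1)
  have hs : (0 : ℝ) ≤ (4 * din n + 6) * Real.log (p n) := by positivity
  have hBn' : 24 * (din n * Real.log (p n)) ≤ n * ((η / 4) ^ 2 / 16) := by
    rw [Real.norm_of_nonneg (by positivity), Real.norm_of_nonneg (by positivity)] at hBn
    linarith
  set good : Set (Ω n) := {ω | SparseConcentration (Sig n) (dataMatrix (X n) ω) η
    (2 * din n + 1) ∧ NoiseBound (Sig n) (dataMatrix (X n) ω) (din n)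
      ((4 * din n + 6) * Real.log (p n))} with hgood
  have hprob : ENNReal.ofReal (1 - 3 * (p n : ℝ)⁻¹) ≤ P n good := by
    have h1 : P n {ω | ¬ SparseConcentration (Sig n) (dataMatrix (X n) ω) η (2 * din n + 1)} ≤
        ENNReal.ofReal (p n : ℝ)⁻¹ := by
      refine (measure_not_sparseConcentration_le (hSig n) (hXlaw n) (hXindep n) hη0.le
        (by linarith) _).trans (ENNReal.ofReal_le_ofReal ?_)
      have := concentration_failure_le (p := p n) (d := din n) (n := n) hpn (hdin n).1 hBn'
      rwa [← mul_div_assoc] at this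
    have h2 : P n {ω | ¬ NoiseBound (Sig n) (dataMatrix (X n) ω) (din n)
        ((4 * din n + 6) * Real.log (p n))} ≤ ENNReal.ofReal (2 * (p n : ℝ)⁻¹) := by
      refine (measure_not_noiseBound_le (hSig n) (hXlaw n) (hXindep n) (din n) hs).trans_eq ?_
      rw [noise_failure_eq hp1]
    -- Subadditivity over a cover replaces passing to complements, so measurability of the event is
    -- never needed.
    have h3 : (1 : ENNReal) ≤ P n good + ENNReal.ofReal (3 * (p n : ℝ)⁻¹) := by
      rw [← measure_univ (μ := P n)]
      have hcover : (Set.univ : Set (Ω n)) ⊆ good ∪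
          ({ω | ¬ SparseConcentration (Sig n) (dataMatrix (X n) ω) η (2 * din n + 1)} ∪
          {ω | ¬ NoiseBound (Sig n) (dataMatrix (X n) ω) (din n)
            ((4 * din n + 6) * Real.log (p n))}) := by
        intro ω _
        by_cases ha : SparseConcentration (Sig n) (dataMatrix (X n) ω) η (2 * din n + 1)
        · by_cases hb : NoiseBound (Sig n) (dataMatrix (X n) ω) (din n)
            ((4 * din n + 6) * Real.log (p n))
          · exact Or.inl ⟨ha, hb⟩
          · exact Or.inr (Or.inr hb)
        · exact Or.inr (Or.inl ha)
      refine (measure_mono hcover).trans ((measure_union_le _ _).trans ?_)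
      gcongr
      refine (measure_union_le _ _).trans ((add_le_add h1 h2).trans_eq ?_)
      rw [← ENNReal.ofReal_add (by positivity) (by positivity)]
      congr 1
      ring
    rw [ENNReal.ofReal_sub _ (by positivity), ENNReal.ofReal_one]
    exact tsub_le_iff_right.2 h3
  refine hprob.trans (measure_mono fun ω hω => ?_)
  set D := dataMatrix (X n) ω with hD
  have hds : ∀ σ j, ((trueParents (Sig n) σ j).card : ℝ) ≤ dStar (Sig n) := fun σ j => by
    exact_mod_cast card_trueParents_le_dStar σ j
  have hcard : ∀ σ j, (trueParents (Sig n) σ j).card ≤ din n := fun σ j => by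
    have h1 := hDP n
    have h2 : 0 ≤ 4 * νhi n ^ 2 * (νlo n ^ 4)⁻¹ * (νhi n - νlo n) ^ 2 * (dStar (Sig n) : ℝ) := by
      positivity
    have h3 := hds σ j
    have : ((trueParents (Sig n) σ j).card : ℝ) ≤ din n := by linarith
    exact_mod_cast this
  have hstar : ∀ σ j, trueParents (Sig n) σ j ∈ candidates σ j (din n) := fun σ j =>
    mem_candidates.2 ⟨trueParents_subset σ j, hcard σ j⟩
  obtain ⟨hH, hpen⟩ := penalty_bounds (H := H n) hp1 (hCc₁ n)
  have hgain : ∀ (σ : Equiv.Perm (Fin (p n))) (j : Fin (p n)), ∀ S ∈ candidates σ j (din n),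
      S ≠ trueParents (Sig n) σ j → t * Real.log (p n) ≤
        nodeScore (H n) D j (transition (nodeScore (H n) D j) (din n) (trueParents (Sig n) σ j) S) -
          nodeScore (H n) D j S := by
    intro σ j S hS hne
    have hmodel := nodeModel_of_event (hSig n) (D := D) (d := din n) hn hs (hνlo n) (hνhi n) hδ₀
      (hA n) hη0.le hηδ hη2 hω.1 hω.2 σ j (hcard σ j)
      (b := betaMin (H n) Cβ (νlo n) (νhi n) (Real.log (p n)) n) fun i hi => by
        rw [← sq_abs]
        exact hEP n σ i j (mem_trueParents.1 hi)
    exact transition_gain hmodel (hα n) (hκ n) (hCκ n) hL hH hpen ht (hCc₂ n) hCβ (hDP n)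
      (hds σ j) (mem_candidates.1 hS).1 (mem_candidates.1 hS).2 hne
  have hnode := fun σ j => posterior_node_concentration hp1 (hstar σ j) (hgain σ j)
  refine ⟨hgain, fun _ σ j => ?_, fun ht3 σ => ?_⟩
  · rw [le_div_iff₀ (Finset.sum_pos (fun _ _ => Real.exp_pos _) ⟨_, hstar σ j⟩)]
    exact hnode σ j
  · rw [le_div_iff₀ (Finset.sum_pos (fun _ _ => Real.exp_pos _) (sparseDAGs_nonempty σ _ _))]
    have hx : (p n : ℝ) ^ (-(t - 2)) ≤ 1 :=
      Real.rpow_le_one_of_one_le_of_nonpos (by exact_mod_cast hp1) (by linarith)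
    -- The factor p from the product over nodes turns the exponent t - 2 into t - 3.
    have hpx : (p n : ℝ) * (p n : ℝ) ^ (-(t - 2)) = (p n : ℝ) ^ (-(t - 3)) := by
      nth_rewrite 1 [← Real.rpow_one (p n : ℝ)]
      rw [← Real.rpow_add hpR]
      congr 1
      ring
    have := posterior_dag_concentration (dout := dout n) hx (hnode σ)
    rw [hpx] at this
    exact this
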